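/- Let $M$ be a $C^3$ manifold without boundary, $g$ a $C^2$ Lorentzian metric on $M$ of signature $(-,+,\dots,+)$, and $n$ a lightlike Killing vector field of class $C^2$, that is, $g(n,n)=0$ everywhere and $n_{\mu;\nu}+n_{\nu;\mu}=0$ (zeros of $n$ are allowed; neither connectedness nor time-orientability of $M$ is needed). Write $n$ also for the 1-form $n_\mu dx^\mu=g(n,\cdot)$, and let $R_{\mu\nu}$ be the Ricci tensor of $g$, with the sign convention $\mathrm{Ric}(v,w)=\operatorname{tr}\bigl(u\mapsto R(u,v)w\bigr)$, $R(u,v)=[\nabla_u,\nabla_v]-\nabla_{[u,v]}$. (1) In any dimension, at every point of $M$, $n\wedge dn=0$ if and only if $R_{\mu\nu}n^\mu n^\nu=0$. In particular, $n\wedge dn=0$ on $M$ if and only if $R_{\mu\nu}n^\mu n^\nu=0$ on $M$. (2) If $\dim M\le 3$, then $n\wedge dn=0$ and $R_{\mu\nu}n^\mu n^\nu=0$ everywhere. (3) If $\dim M=4$, then $R_{\mu\nu}n^\mu n^\nu\ge 0$ everywhere. Moreover, let $U\subseteq M$ be open and let $\epsilon_{\alpha\beta\gamma\delta}$ be a Levi-Civita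 tensor of $g$ on $U$ (a continuous 4-form equal to $\pm1$ on orthonormal frames; if $M$ is oriented one can take $U=M$). Put $$z_\alpha:=2\,\epsilon_{\alpha\beta\gamma\delta}\,n^\beta n^{[\gamma;\delta]},\qquad n^{[\gamma;\delta]}=\tfrac12\,(n^{\gamma;\delta}-n^{\delta;\gamma}).$$ Then at every point of $U$ $$z_\alpha=\pm\,(8R_{\mu\nu}n^\mu n^\nu)^{1/2}\,n_\alpha ,$$ and on every non-empty connected subset of $\{x\in U: R_{\mu\nu}n^\mu n^\nu>0\}$ the sign is uniquely determined and constant. -/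

import Mathlib

set_option maxSynthPendingDepth 3

open scoped Manifold ContDiff Topology

noncomputable section

namespace Spacetime

/-! ### Tensor calculus on an open set of a vector space `E`

`G : E → E →L[ℝ] E →L[ℝ] ℝ` is the coordinate expression of a metric, `N : E → E` that of a vector
field, `y` a point, and `u v w : E` are tangent vectors at `y`. -/

section Coordinates

variable {E : Type*} [NormedAddCommGroup E] [NormedSpace ℝ E]

/-- Christoffel symbols of the first kind:
`(u, v, w) ↦ (1/2) (∂_u G(v, w) + ∂_v G(u, w) - ∂_w G(u, v))`. -/
def christoffelLower (G : E → E →L[ℝ] E →L[ℝ] ℝ) (y : E) : E →L[ℝ] E →L[ℝ] E →L[ℝ] ℝ :=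
  let D : E →L[ℝ] E →L[ℝ] E →L[ℝ] ℝ := fderiv ℝ G y
  (1 / 2 : ℝ) • (D + D.flip -
    (ContinuousLinearMap.flipₗᵢ ℝ E E ℝ).toContinuousLinearEquiv.toContinuousLinearMap ∘L D.flip)

theorem christoffelLower_apply (G : E → E →L[ℝ] E →L[ℝ] ℝ) (y u v w : E) :
    christoffelLower G y u v w =
      (1 / 2) * (fderiv ℝ G y u v w + fderiv ℝ G y v u w - fderiv ℝ G y w u v) := by
  simp [christoffelLower]

/-- Christoffel symbols of the second kind, `Γ(u, v)`: the vector with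
`G(Γ(u, v), w) = christoffelLower G y u v w` for all `w`.
(`(G y).inverse` raises the index; it is the true inverse whenever `G y` is nondegenerate.) -/
def christoffel (G : E → E →L[ℝ] E →L[ℝ] ℝ) (y : E) : E →L[ℝ] E →L[ℝ] E :=
  (ContinuousLinearMap.compL ℝ E (E →L[ℝ] ℝ) E (G y).inverse) ∘L christoffelLower G y

theorem christoffel_apply (G : E → E →L[ℝ] E →L[ℝ] ℝ) (y u v : E) :
    christoffel G y u v = (G y).inverse (christoffelLower G y u v) := rfl

/-- Levi-Civita covariant derivative of a vector field: `∇_u N = ∂_u N + Γ(u, N)`. -/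
def covDeriv (G : E → E →L[ℝ] E →L[ℝ] ℝ) (N : E → E) (y : E) : E →L[ℝ] E :=
  fderiv ℝ N y + (christoffel G y).flip (N y)

/-- Riemann curvature `R(u, v) w = ∇_u ∇_v w - ∇_v ∇_u w` for constant `u`, `v`, `w`. -/
def riemann (G : E → E →L[ℝ] E →L[ℝ] ℝ) (y u v w : E) : E :=
  fderiv ℝ (christoffel G) y u v w - fderiv ℝ (christoffel G) y v u w
    + christoffel G y u (christoffel G y v w) - christoffel G y v (christoffel G y u w)

/-- Ricci curvature `Ric(v, w) = tr (u ↦ R(u, v) w)`. -/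
def ricci (G : E → E →L[ℝ] E →L[ℝ] ℝ) (y v w : E) : ℝ :=
  LinearMap.trace ℝ E
    { toFun := fun u => riemann G y u v w
      map_add' := fun a b => by simp [riemann]; abel
      map_smul' := fun a b => by simp [riemann, smul_sub, smul_add] }

/-- The 1-form `n_μ dx^μ` obtained from the vector field `N` by lowering the index. -/
def lower (G : E → E →L[ℝ] E →L[ℝ] ℝ) (N : E → E) (y : E) : E [⋀^Fin 1]→L[ℝ] ℝ :=
  ContinuousAlternatingMap.ofSubsingleton ℝ E ℝ (0 : Fin 1) (G y (N y))

end Coordinates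

/-! ### Lorentzian manifolds -/

section Manifold

variable {E : Type*} [NormedAddCommGroup E] [NormedSpace ℝ E]
  {M : Type*} [TopologicalSpace M] [ChartedSpace E M] [IsManifold 𝓘(ℝ, E) 3 M]

variable (E M) in
/-- A `C²` Lorentzian metric of signature `(-, +, …, +)` on the `C³` manifold `M`. -/
structure LorentzMetric where
  /-- the bilinear form on each tangent space -/
  form : ∀ x : M, TangentSpace 𝓘(ℝ, E) x →L[ℝ] TangentSpace 𝓘(ℝ, E) x →L[ℝ] ℝ
  symm : ∀ (x : M) (u v : TangentSpace 𝓘(ℝ, E) x), form x u v = form x v u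
  /-- some vector is timelike and the form is positive definite on its orthogonal complement -/
  lorentzian : ∀ x : M, ∃ t : TangentSpace 𝓘(ℝ, E) x, form x t t < 0 ∧
    ∀ v : TangentSpace 𝓘(ℝ, E) x, form x t v = 0 → v ≠ 0 → 0 < form x v v
  contMDiff : ContMDiff 𝓘(ℝ, E) (𝓘(ℝ, E).prod 𝓘(ℝ, E →L[ℝ] E →L[ℝ] ℝ)) 2
    (fun x => Bundle.TotalSpace.mk' (E →L[ℝ] E →L[ℝ] ℝ)
      (E := fun x : M => TangentSpace 𝓘(ℝ, E) x →L[ℝ] TangentSpace 𝓘(ℝ, E) x →L[ℝ] ℝ) x (form x))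

/-- The differential at `y : E` of the inverse of the chart around `c`; its values on a basis of `E`
are the coordinate vector fields of that chart. -/
def frame (c : M) (y : E) :
    E →L[ℝ] TangentSpace 𝓘(ℝ, E) ((extChartAt 𝓘(ℝ, E) c).symm y) :=
  mfderiv 𝓘(ℝ, E) 𝓘(ℝ, E) (extChartAt 𝓘(ℝ, E) c).symm y

/-- The differential at `x` of the chart around `x`. -/
def coord (x : M) : TangentSpace 𝓘(ℝ, E) x →L[ℝ] E :=
  mfderiv 𝓘(ℝ, E) 𝓘(ℝ, E) (extChartAt 𝓘(ℝ, E) x) x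

/-- Coordinate expression `G(y)(u, v) = g(∂_u, ∂_v)` of the metric in the chart around `c`. -/
def LorentzMetric.inChart (g : LorentzMetric E M) (c : M) (y : E) : E →L[ℝ] E →L[ℝ] ℝ :=
  ContinuousLinearMap.bilinearComp (E := E) (F := E)
    (g.form ((extChartAt 𝓘(ℝ, E) c).symm y)) (frame c y) (frame c y)

theorem LorentzMetric.inChart_apply (g : LorentzMetric E M) (c : M) (y u v : E) :
    g.inChart c y u v =
      g.form ((extChartAt 𝓘(ℝ, E) c).symm y) (frame c y u) (frame c y v) := rfl

/-- Coordinate expression of a vector field in the chart around `c`. -/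
def fieldInChart (n : ∀ x : M, TangentSpace 𝓘(ℝ, E) x) (c : M) : E → E :=
  VectorField.mpullback 𝓘(ℝ, E) 𝓘(ℝ, E) (extChartAt 𝓘(ℝ, E) c).symm n

/-- The covariant derivative `u ↦ ∇_u n` at `x`, for the Levi-Civita connection of `g`. -/
def LorentzMetric.nabla (g : LorentzMetric E M) (n : ∀ x : M, TangentSpace 𝓘(ℝ, E) x) (x : M)
    (u : TangentSpace 𝓘(ℝ, E) x) : TangentSpace 𝓘(ℝ, E) x :=
  (coord x).inverse
    (covDeriv (g.inChart x) (fieldInChart n x) (extChartAt 𝓘(ℝ, E) x x) (coord x u))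

/-- The Ricci tensor `R_{μν} u^μ v^ν` of `g` at `x`. -/
def LorentzMetric.ric (g : LorentzMetric E M) (x : M) (u v : TangentSpace 𝓘(ℝ, E) x) : ℝ :=
  ricci (g.inChart x) (extChartAt 𝓘(ℝ, E) x x) (coord x u) (coord x v)

/-- The exterior derivative at `x` of the 1-form `n_μ dx^μ = g(n, ·)`. -/
def LorentzMetric.dLower (g : LorentzMetric E M) (n : ∀ x : M, TangentSpace 𝓘(ℝ, E) x) (x : M)
    (u v : TangentSpace 𝓘(ℝ, E) x) : ℝ :=
  extDeriv (lower (g.inChart x) (fieldInChart n x)) (extChartAt 𝓘(ℝ, E) x x)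
    ![coord x u, coord x v]

/-- The 3-form `n ∧ dn` at `x`, where `n` also denotes the 1-form `g(n, ·)`. -/
def LorentzMetric.wedgeD (g : LorentzMetric E M) (n : ∀ x : M, TangentSpace 𝓘(ℝ, E) x) (x : M)
    (u v w : TangentSpace 𝓘(ℝ, E) x) : ℝ :=
  g.form x (n x) u * g.dLower n x v w + g.form x (n x) v * g.dLower n x w u
    + g.form x (n x) w * g.dLower n x u v

/-- `n` is a lightlike Killing vector field (of class `C²`, like the metric). The Killing equation
`n_{μ;ν} + n_{ν;μ} = 0` is required at all points of all charts of the atlas `{chart around c}`.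
Zeros of `n` are allowed. -/
structure LorentzMetric.IsLightlikeKilling (g : LorentzMetric E M)
    (n : ∀ x : M, TangentSpace 𝓘(ℝ, E) x) : Prop where
  contMDiff : ContMDiff 𝓘(ℝ, E) 𝓘(ℝ, E).tangent 2
    (fun x => (⟨x, n x⟩ : TangentBundle 𝓘(ℝ, E) M))
  lightlike : ∀ x : M, g.form x (n x) (n x) = 0
  killing : ∀ c : M, ∀ y ∈ (extChartAt 𝓘(ℝ, E) c).target, ∀ u v : E,
    g.inChart c y (covDeriv (g.inChart c) (fieldInChart n c) y v) u
      + g.inChart c y (covDeriv (g.inChart c) (fieldInChart n c) y u) v = 0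

/-- `ε` is the Levi-Civita tensor `ε_{αβγδ}` of `g` (for one of the orientations) over the subset
`U` of a four-dimensional spacetime: a continuous 4-form, equal to `±1` on orthonormal frames,
equivalently with `ε(v₀, v₁, v₂, v₃)² = - det (g(v_i, v_j))`. -/
structure LorentzMetric.IsVolumeForm (g : LorentzMetric E M) (U : Set M)
    (ε : ∀ x : M, TangentSpace 𝓘(ℝ, E) x [⋀^Fin 4]→ₗ[ℝ] ℝ) : Prop where
  sq_eq : ∀ x ∈ U, ∀ v : Fin 4 → TangentSpace 𝓘(ℝ, E) x,
    ε x v ^ 2 = - (Matrix.of fun i j => g.form x (v i) (v j)).det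
  continuousOn : ∀ (c : M) (v : Fin 4 → E),
    ContinuousOn
      (fun y => ε ((extChartAt 𝓘(ℝ, E) c).symm y) (fun i => frame c y (v i)))
      ((extChartAt 𝓘(ℝ, E) c).target ∩ (extChartAt 𝓘(ℝ, E) c).symm ⁻¹' U)

variable [FiniteDimensional ℝ E]

/-- A basis of the tangent space, used to write contractions; the contractions below do not depend
on the choice. -/
def tangentBasis (x : M) :
    Module.Basis (Fin (Module.finrank ℝ E)) ℝ (TangentSpace 𝓘(ℝ, E) x) :=
  Module.finBasis ℝ E

/-- The components `g^{γδ}` of the inverse metric with respect to `tangentBasis x`. -/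
def LorentzMetric.invMetric (g : LorentzMetric E M) (x : M) :
    Matrix (Fin (Module.finrank ℝ E)) (Fin (Module.finrank ℝ E)) ℝ :=
  (Matrix.of fun γ δ => g.form x (tangentBasis x γ) (tangentBasis x δ))⁻¹

/-- The component `n^{γ;δ} = g^{δσ} n^γ_{;σ}` with respect to `tangentBasis x`. -/
def LorentzMetric.nablaUp (g : LorentzMetric E M) (n : ∀ x : M, TangentSpace 𝓘(ℝ, E) x) (x : M)
    (γ δ : Fin (Module.finrank ℝ E)) : ℝ :=
  ∑ σ, g.invMetric x δ σ * (tangentBasis x).coord γ (g.nabla n x (tangentBasis x σ))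

/-- The twist 1-form `z_α = 2 ε_{αβγδ} n^β n^{[γ;δ]}` at `x`, evaluated on the vector `u`. -/
def LorentzMetric.twist (g : LorentzMetric E M) (n : ∀ x : M, TangentSpace 𝓘(ℝ, E) x)
    (ε : ∀ x : M, TangentSpace 𝓘(ℝ, E) x [⋀^Fin 4]→ₗ[ℝ] ℝ) (x : M)
    (u : TangentSpace 𝓘(ℝ, E) x) : ℝ :=
  2 * ∑ γ, ∑ δ, ε x ![u, n x, tangentBasis x γ, tangentBasis x δ]
    * ((g.nablaUp n x γ δ - g.nablaUp n x δ γ) / 2)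

end Manifold

end Spacetime

end

/-! Write `A` for the endomorphism `u ↦ ∇_u n`. The Killing equation says that `A` is skew for `g`,
so `dn = 2 g(A ·, ·)`. Differentiating `g(n, n) = 0` gives `g(A u, n) = 0`, and skewness turns this
into `A n = 0`. The Ricci identity contracted with `n`, together with `A n = 0` and `tr A = 0`,
becomes `Ric(n, n) = -tr (A ∘ A)` (`ricci_eq`). From here on everything except the constancy of the
sign is linear algebra at one point.

Where `n ≠ 0`, complete it to a frame `n, w, e_i` with `w` null, `g(n, w) = -1` and `e_i`
orthonormal in the complement. The image of `A` is orthogonal to `n`, so only the transverse block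
`A_ij = g(A e_i, e_j)` enters the trace: `-tr (A ∘ A) = ∑ A_ij ^ 2` (`neg_trace_sq`). The same block
is the obstruction to `n ∧ dn = 0`: evaluation on `w, e_i, e_j` gives `-2 A_ij`, and if the block
vanishes then `n` divides `dn`. The block is skew of size `dim - 2`, hence zero when `dim ≤ 3`. When
`dim = 4` it has a single entry `a` up to sign; then `Ric(n, n) = 2 a ^ 2`, and the twist is `c n`
with `c = ± 4 a`, so `c ^ 2 = 8 Ric(n, n)`. At zeros of `n` all claims are trivial.

For the sign, `n ∧ dn = (c / 2) ε(n, ·, ·, ·)`. Both 3-forms are continuous, so the product of their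
values on the same arguments is a continuous function `(c / 2) ε(n, p, q, r) ^ 2` that carries the
sign of `c`. This makes the sign locally constant where `Ric(n, n) > 0`. -/

noncomputable section

namespace Spacetime

/-! ### Null frames -/

section NullFrame

variable {V : Type*} [AddCommGroup V] [Module ℝ V]

/-- A frame `n, w, e₀, …, e_{k-1}` of a Lorentzian vector space consisting of two null vectors with
product `-1` and an orthonormal frame of their orthogonal complement. -/
structure IsNullFrame (B : V →ₗ[ℝ] V →ₗ[ℝ] ℝ) (n w : V) {k : ℕ} (e : Fin k → V) : Prop where
  symm : ∀ u v, B u v = B v u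
  nn : B n n = 0
  ww : B w w = 0
  nw : B n w = -1
  ne : ∀ i, B n (e i) = 0
  we : ∀ i, B w (e i) = 0
  ee : ∀ i j, B (e i) (e j) = if i = j then 1 else 0
  expand : ∀ v, v = -(B w v) • n - (B n v) • w + ∑ i, B (e i) v • e i

theorem exists_orthonormal_basis_of_posDef [FiniteDimensional ℝ V] (B : V →ₗ[ℝ] V →ₗ[ℝ] ℝ)
    (symm : ∀ u v, B u v = B v u) (pos : ∀ v, v ≠ 0 → 0 < B v v) :
    ∃ (k : ℕ) (e : Fin k → V), (∀ i j, B (e i) (e j) = if i = j then 1 else 0) ∧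
      ∀ v, v = ∑ i, B (e i) v • e i := by
  obtain ⟨b, hb⟩ := LinearMap.BilinForm.exists_orthogonal_basis (B := B) ⟨fun u v => symm u v⟩
  have hp : ∀ i, 0 < B (b i) (b i) := fun i => pos _ (b.ne_zero i)
  have hs : ∀ i, √(B (b i) (b i)) ≠ 0 := fun i => (Real.sqrt_pos.2 (hp i)).ne'
  have hee : ∀ i j, B ((√(B (b i) (b i)))⁻¹ • b i) ((√(B (b j) (b j)))⁻¹ • b j) =
      if i = j then 1 else 0 := by
    intro i j
    split_ifs with h
    · subst h
      have := Real.mul_self_sqrt (hp i).le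
      have h0 := hs i
      simp only [map_smul, LinearMap.smul_apply, smul_eq_mul]
      field_simp
      nlinarith
    · have : B (b i) (b j) = 0 := hb h
      simp [this]
  refine ⟨_, fun i => (√(B (b i) (b i)))⁻¹ • b i, hee, fun v => ?_⟩
  have hv : v = ∑ i, (b.repr v i * √(B (b i) (b i))) • ((√(B (b i) (b i)))⁻¹ • b i) := by
    conv_lhs => rw [← b.sum_repr v]
    refine Finset.sum_congr rfl fun i _ => ?_
    rw [smul_smul, mul_assoc, mul_inv_cancel₀ (hs i), mul_one]
  conv_lhs => rw [hv]
  refine Finset.sum_congr rfl fun i _ => ?_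
  congr 1
  conv_rhs => rw [hv]
  rw [map_sum]
  simp_rw [map_smul _ (b.repr v _ * _), hee]
  simp

/-- A timelike `t` is never orthogonal to the null vector `n ≠ 0`, so the plane they span contains a
second null direction `w`. The complement of that plane is orthogonal to `t`, hence positive
definite. -/
theorem exists_isNullFrame [FiniteDimensional ℝ V] (B : V →ₗ[ℝ] V →ₗ[ℝ] ℝ)
    (symm : ∀ u v, B u v = B v u)
    (lor : ∃ t, B t t < 0 ∧ ∀ v, B t v = 0 → v ≠ 0 → 0 < B v v) {n : V} (hn : n ≠ 0)
    (nn : B n n = 0) : ∃ (w : V) (k : ℕ) (e : Fin k → V), IsNullFrame B n w e := by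
  obtain ⟨t, ht, hpos⟩ := lor
  have htn : B t n ≠ 0 := fun h => (hpos n h hn).ne' nn
  have hnt : B n t = B t n := symm _ _
  -- The scale `a` gives `B n w = -1`; the coefficient of `n` in `w` is then the one that makes `B w
  -- w = 0`.
  set a : ℝ := -(B t n)⁻¹ with ha
  have hat : a * B t n = -1 := by rw [ha]; field_simp
  have ha0 : a ≠ 0 := by rw [ha]; simpa using htn
  set w : V := a • t + (a ^ 2 * B t t / 2) • n with hw
  have nw : B n w = -1 := by simp [hw, nn, hnt, hat]
  have ww : B w w = 0 := by
    simp only [hw, map_add, map_smul, LinearMap.add_apply, LinearMap.smul_apply, smul_eq_mul, nn,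
      hnt]
    linear_combination (a ^ 2 * B t t) * hat
  let S : Submodule ℝ V := LinearMap.ker (B n) ⊓ LinearMap.ker (B w)
  have hS : ∀ v, v ∈ S ↔ B n v = 0 ∧ B w v = 0 := fun v => by simp [S]
  obtain ⟨k, e, hee, hexp⟩ := exists_orthonormal_basis_of_posDef
    (B.compl₁₂ S.subtype S.subtype) (fun u v => symm _ _) (by
      intro v hv
      obtain ⟨h1, h2⟩ := (hS v).1 v.2
      refine hpos v ?_ (by simpa using hv)
      have : a * B t v = 0 := by
        simpa [hw, h1] using h2
      exact (mul_eq_zero.1 this).resolve_left ha0)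
  have he := fun i => (hS (e i)).1 (e i).2
  refine ⟨w, k, fun i => e i, symm, nn, ww, nw, fun i => (he i).1, fun i => (he i).2,
    fun i j => hee i j, fun v => ?_⟩
  have hv : v + B w v • n + B n v • w ∈ S := by
    rw [hS]
    simp [nn, nw, ww, symm w n]
  have h := congrArg Subtype.val (hexp ⟨_, hv⟩)
  simp only [LinearMap.compl₁₂_apply, Submodule.subtype_apply, Submodule.coe_sum,
    Submodule.coe_smul] at h
  have h3 : ∀ i, B (e i) (v + B w v • n + B n v • w) = B (e i) v := fun i => by
    simp [symm (e i) n, symm (e i) w, he i]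
  simp only [h3] at h
  rw [← h]
  module

namespace IsNullFrame

variable {B : V →ₗ[ℝ] V →ₗ[ℝ] ℝ} {n w : V} {k : ℕ} {e : Fin k → V}

/-- The coframe dual to `n, w, e_i` is `-B w, -B n, B (e_i)`, so `expand` writes `L` as a sum of
rank-one maps, whose traces are evaluations. -/
theorem trace_eq [FiniteDimensional ℝ V] (h : IsNullFrame B n w e) (L : V →ₗ[ℝ] V) :
    LinearMap.trace ℝ V L = -B w (L n) - B n (L w) + ∑ i, B (e i) (L (e i)) := by
  have hL : L = -((B w).smulRight (L n)) - (B n).smulRight (L w)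
      + ∑ i, (B (e i)).smulRight (L (e i)) := by
    ext v
    conv_lhs => rw [h.expand v]
    simp
  conv_lhs => rw [hL]
  simp only [map_add, map_sub, map_neg, map_sum, LinearMap.trace_smulRight]

theorem finrank_eq [FiniteDimensional ℝ V] (h : IsNullFrame B n w e) :
    Module.finrank ℝ V = k + 2 := by
  have := h.trace_eq LinearMap.id
  simp only [LinearMap.trace_id, LinearMap.id_apply, h.symm w n, h.nw, h.ee] at this
  have h2 : (Module.finrank ℝ V : ℝ) = ((k + 2 : ℕ) : ℝ) := by
    rw [this]; simp; ring
  exact_mod_cast h2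

/-! ### Skew endomorphisms that annihilate the null vector -/

section Skew

variable {A : V →ₗ[ℝ] V} (h : IsNullFrame B n w e) (hA : ∀ u v, B (A u) v + B (A v) u = 0)
  (hn : A n = 0)

include hA hn in
theorem apply_right_null (u : V) : B (A u) n = 0 := by
  have := hA u n
  simpa [hn] using this

include h hA hn

/-- The image of `A` is orthogonal to `n`, so the two null directions contribute nothing to the
trace. Skewness turns the remaining terms into squared lengths `B (A e_i) (A e_i)`, and these only
see the components along the `e_j`. -/
theorem neg_trace_sq [FiniteDimensional ℝ V] :
    -LinearMap.trace ℝ V (A ∘ₗ A) = ∑ i, ∑ j, B (A (e i)) (e j) ^ 2 := by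
  have h0 := apply_right_null hA hn
  have h1 : ∀ i, B (e i) (A (A (e i))) = -∑ j, B (A (e i)) (e j) ^ 2 := by
    intro i
    have h2 : B (A (e i)) (A (e i)) = ∑ j, B (A (e i)) (e j) ^ 2 := by
      conv_lhs =>
        enter [2]
        rw [h.expand (A (e i))]
      simp [h0, h.symm n (A (e i)), sq, h.symm (e _) (A (e i))]
    rw [h.symm, ← h2]
    linarith [hA (A (e i)) (e i)]
  rw [h.trace_eq]
  simp [hn, h.symm n, h0, h1]

/-- With no transverse block, the 2-form `B (A ·) ·` is the wedge of `n` with a 1-form, that is,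
divisible by `n`. -/
theorem skew_expand (h0 : ∀ i j, B (A (e i)) (e j) = 0) (u v : V) :
    B (A u) v = B n v * B (A w) u - B n u * B (A w) v := by
  have hr := apply_right_null hA hn
  have h1 : ∀ i, B (A (e i)) v = -(B n v) * B (A (e i)) w := by
    intro i
    conv_lhs => rw [h.expand v]
    simp [hr, h0]
  have h2 : ∀ i, B (A (e i)) v = B n v * B (A w) (e i) := by
    intro i
    rw [h1]
    linear_combination (-B n v) * hA (e i) w
  have hww : B (A w) w = 0 := by linarith [hA w w]
  have h3 : B (A w) u = ∑ i, B (e i) u * B (A w) (e i) := by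
    conv_lhs => rw [h.expand u]
    simp [hr, hww]
  have h4 : B (A u) v = -(B n u) * B (A w) v + ∑ i, B (e i) u * B (A (e i)) v := by
    conv_lhs => rw [h.expand u]
    simp [hn]
  rw [h4, h3, Finset.mul_sum, neg_mul, neg_add_eq_sub]
  congr 1
  refine Finset.sum_congr rfl fun i _ => ?_
  rw [h2]; ring

/-- The triples `w, e_i, e_j` read off the transverse block. Conversely, a 2-form divisible by `n`
dies in the cyclic sum. -/
theorem wedge_eq_zero_iff [FiniteDimensional ℝ V] :
    (∀ p q r, B n p * (2 * B (A q) r) + B n q * (2 * B (A r) p) + B n r * (2 * B (A p) q) = 0) ↔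
      -LinearMap.trace ℝ V (A ∘ₗ A) = 0 := by
  rw [neg_trace_sq h hA hn]
  constructor
  · intro hW
    refine Finset.sum_eq_zero fun i _ => Finset.sum_eq_zero fun j _ => ?_
    have := hW w (e i) (e j)
    rw [h.ne, h.ne, h.nw] at this
    have : B (A (e i)) (e j) = 0 := by linarith
    simp [this]
  · intro hs p q r
    have h0 : ∀ i j, B (A (e i)) (e j) = 0 := by
      intro i j
      rw [Finset.sum_eq_zero_iff_of_nonneg
        (fun i _ => Finset.sum_nonneg fun j _ => sq_nonneg _)] at hs
      have := hs i (Finset.mem_univ _)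
      rw [Finset.sum_eq_zero_iff_of_nonneg (fun j _ => sq_nonneg _)] at this
      exact pow_eq_zero_iff (two_ne_zero) |>.1 (this j (Finset.mem_univ _))
    rw [skew_expand h hA hn h0 q r, skew_expand h hA hn h0 r p, skew_expand h hA hn h0 p q]
    ring

theorem neg_trace_sq_nonneg [FiniteDimensional ℝ V] : 0 ≤ -LinearMap.trace ℝ V (A ∘ₗ A) := by
  rw [neg_trace_sq h hA hn]
  exact Finset.sum_nonneg fun i _ => Finset.sum_nonneg fun j _ => sq_nonneg _

theorem neg_trace_sq_eq_zero_of_finrank_le [FiniteDimensional ℝ V]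
    (hd : Module.finrank ℝ V ≤ 3) : -LinearMap.trace ℝ V (A ∘ₗ A) = 0 := by
  rw [neg_trace_sq h hA hn]
  -- The transverse block is skew and at most 1 × 1.
  have hk : k ≤ 1 := by have := h.finrank_eq; omega
  refine Finset.sum_eq_zero fun i _ => Finset.sum_eq_zero fun j _ => ?_
  have hij : i = j := by ext; omega
  subst hij
  have : B (A (e i)) (e i) = 0 := by linarith [hA (e i) (e i)]
  simp [this]

end Skew

end IsNullFrame

end NullFrame

/-! ### Dimension four: contraction with the volume form -/

section FourDimensional

variable {V : Type*} [AddCommGroup V] [Module ℝ V]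

/-- The multilinear map of four curried arguments underlying a 4-form. -/
def curryFour (ε : V [⋀^Fin 4]→ₗ[ℝ] ℝ) : V →ₗ[ℝ] V →ₗ[ℝ] V →ₗ[ℝ] V →ₗ[ℝ] ℝ :=
  have h₀ (a b c d x : V) : Function.update ![a, b, c, d] 0 x = ![x, b, c, d] := by
    ext i; fin_cases i <;> rfl
  have h₁ (a b c d x : V) : Function.update ![a, b, c, d] 1 x = ![a, x, c, d] := by
    ext i; fin_cases i <;> rfl
  have h₂ (a b c d x : V) : Function.update ![a, b, c, d] 2 x = ![a, b, x, d] := by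
    ext i; fin_cases i <;> rfl
  have h₃ (a b c d x : V) : Function.update ![a, b, c, d] 3 x = ![a, b, c, x] := by
    ext i; fin_cases i <;> rfl
  LinearMap.mk₂ ℝ
    (fun a b => LinearMap.mk₂ ℝ (fun c d => ε ![a, b, c, d])
      (fun c c' d => by simpa only [h₂] using ε.map_update_add ![a, b, 0, d] 2 c c')
      (fun r c d => by simpa only [h₂] using ε.map_update_smul ![a, b, 0, d] 2 r c)
      (fun c d d' => by simpa only [h₃] using ε.map_update_add ![a, b, c, 0] 3 d d')
      (fun r c d => by simpa only [h₃] using ε.map_update_smul ![a, b, c, 0] 3 r d))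
    (fun a a' b => by
      ext c d
      have := ε.map_update_add ![0, b, c, d] 0 a a'
      simp only [h₀] at this
      exact this)
    (fun r a b => by
      ext c d
      have := ε.map_update_smul ![0, b, c, d] 0 r a
      simp only [h₀] at this
      exact this)
    (fun a b b' => by
      ext c d
      have := ε.map_update_add ![a, 0, c, d] 1 b b'
      simp only [h₁] at this
      exact this)
    (fun r a b => by
      ext c d
      have := ε.map_update_smul ![a, 0, c, d] 1 r b
      simp only [h₁] at this
      exact this)

@[simp]
theorem curryFour_apply (ε : V [⋀^Fin 4]→ₗ[ℝ] ℝ) (a b c d : V) :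
    curryFour ε a b c d = ε ![a, b, c, d] := rfl

theorem curryFour_swap₀₁ (ε : V [⋀^Fin 4]→ₗ[ℝ] ℝ) (a b c d : V) :
    curryFour ε a b c d = -curryFour ε b a c d := by
  have := ε.map_swap ![b, a, c, d] (i := 0) (j := 1) (by decide)
  rw [curryFour_apply, curryFour_apply, ← this]
  congr 1; ext i; fin_cases i <;> rfl

theorem curryFour_swap₁₂ (ε : V [⋀^Fin 4]→ₗ[ℝ] ℝ) (a b c d : V) :
    curryFour ε a b c d = -curryFour ε a c b d := by
  have := ε.map_swap ![a, c, b, d] (i := 1) (j := 2) (by decide)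
  rw [curryFour_apply, curryFour_apply, ← this]
  congr 1; ext i; fin_cases i <;> rfl

theorem curryFour_swap₂₃ (ε : V [⋀^Fin 4]→ₗ[ℝ] ℝ) (a b c d : V) :
    curryFour ε a b c d = -curryFour ε a b d c := by
  have := ε.map_swap ![a, b, d, c] (i := 2) (j := 3) (by decide)
  rw [curryFour_apply, curryFour_apply, ← this]
  congr 1; ext i; fin_cases i <;> rfl

/-- The contraction of the 4-form `ε` with `u`, `n` and the bivector `g^{δσ} A^γ_σ` obtained from
the endomorphism `A` by raising an index. -/
def contractTwist {ι : Type*} [Fintype ι] [DecidableEq ι] (B : V →ₗ[ℝ] V →ₗ[ℝ] ℝ)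
    (b : Module.Basis ι ℝ V) (A : V →ₗ[ℝ] V) (n : V) (ε : V [⋀^Fin 4]→ₗ[ℝ] ℝ) (u : V) : ℝ :=
  let F : ι → ι → ℝ := fun γ δ =>
    ∑ σ, (Matrix.of fun γ δ => B (b γ) (b δ))⁻¹ δ σ * b.coord γ (A (b σ))
  2 * ∑ γ, ∑ δ, ε ![u, n, b γ, b δ] * ((F γ δ - F δ γ) / 2)

namespace IsNullFrame

variable {B : V →ₗ[ℝ] V →ₗ[ℝ] ℝ} {n w : V} {k : ℕ} {e : Fin k → V}

theorem _root_.Module.Basis.sum_coord_mul_apply {ι : Type*} [Fintype ι] (b : Module.Basis ι ℝ V)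
    (f : V →ₗ[ℝ] ℝ) (v : V) : ∑ δ, b.coord δ v * f (b δ) = f v := by
  conv_rhs => rw [← b.sum_repr v]
  simp only [map_sum, map_smul, smul_eq_mul, Module.Basis.coord_apply]

/-- The inverse metric is the tensor `-n ⊗ w - w ⊗ n + ∑ e_i ⊗ e_i`, here in components for `b`. It
converts contractions over an arbitrary basis into sums over the null frame. -/
theorem gram_inv {ι : Type*} [Fintype ι] [DecidableEq ι] (h : IsNullFrame B n w e)
    (b : Module.Basis ι ℝ V) :
    (Matrix.of fun γ δ => B (b γ) (b δ))⁻¹ = Matrix.of fun δ σ =>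
      -(b.coord δ n * b.coord σ w) - b.coord δ w * b.coord σ n
        + ∑ i, b.coord δ (e i) * b.coord σ (e i) := by
  refine Matrix.inv_eq_right_inv ?_
  ext τ σ
  have key : ∀ v, ∑ δ, B (b τ) (b δ) * b.coord δ v = B (b τ) v := by
    intro v
    simpa only [mul_comm] using b.sum_coord_mul_apply (B (b τ)) v
  have h1 : b.coord σ (b τ) = (1 : Matrix ι ι ℝ) τ σ := by
    simp [Matrix.one_apply, Finsupp.single_apply]
  rw [← h1]
  conv_rhs => rw [h.expand (b τ)]
  simp only [Matrix.mul_apply, Matrix.of_apply, mul_add, mul_sub, mul_neg, Finset.sum_add_distrib,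
    Finset.sum_sub_distrib, Finset.sum_neg_distrib, ← mul_assoc, ← Finset.sum_mul, key,
    map_add, map_sub, map_smul, map_sum, smul_eq_mul, neg_smul, map_neg, Finset.mul_sum]
  rw [Finset.sum_comm]
  simp only [← Finset.sum_mul, key]
  simp only [h.symm (b τ)]
  ring

theorem contractTwist_eq {ι : Type*} [Fintype ι] [DecidableEq ι] (h : IsNullFrame B n w e)
    (b : Module.Basis ι ℝ V) (A : V →ₗ[ℝ] V) (ε : V [⋀^Fin 4]→ₗ[ℝ] ℝ) (u : V) :
    contractTwist B b A n ε u = 2 * (-ε ![u, n, A n, w] - ε ![u, n, A w, n]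
      + ∑ i, ε ![u, n, A (e i), e i]) := by
  simp only [contractTwist, h.gram_inv b]
  set T : V →ₗ[ℝ] V →ₗ[ℝ] ℝ := curryFour ε u n with hT
  have hTε : ∀ p q, ε ![u, n, p, q] = T p q := fun _ _ => rfl
  have hTs : ∀ p q, T p q = -T q p := fun p q => curryFour_swap₂₃ ε u n p q
  simp only [hTε]
  set F : ι → ι → ℝ := fun γ δ => ∑ σ, (Matrix.of fun δ σ =>
      -(b.coord δ n * b.coord σ w) - b.coord δ w * b.coord σ n
        + ∑ i, b.coord δ (e i) * b.coord σ (e i)) δ σ * b.coord γ (A (b σ)) with hF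
  have hex : ∀ γ δ, F γ δ = -(b.coord γ (A w) * b.coord δ n) - b.coord γ (A n) * b.coord δ w
      + ∑ i, b.coord γ (A (e i)) * b.coord δ (e i) := by
    intro γ δ
    have key : ∀ v, ∑ σ, b.coord σ v * b.coord γ (A (b σ)) = b.coord γ (A v) := by
      exact fun v => b.sum_coord_mul_apply (b.coord γ ∘ₗ A) v
    simp only [hF, Matrix.of_apply, add_mul, sub_mul, neg_mul, Finset.sum_add_distrib,
      Finset.sum_sub_distrib, Finset.sum_neg_distrib, mul_assoc, ← Finset.mul_sum, key,
      Finset.sum_mul]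
    rw [Finset.sum_comm]
    simp only [← Finset.mul_sum, key]
    simp only [mul_comm]
  have hcon : ∀ p q, ∑ γ, ∑ δ, T (b γ) (b δ) * (b.coord γ p * b.coord δ q) = T p q := by
    intro p q
    rw [← T.flip_apply, ← b.sum_coord_mul_apply (T.flip q) p]
    refine Finset.sum_congr rfl fun γ _ => ?_
    rw [LinearMap.flip_apply, ← b.sum_coord_mul_apply (T (b γ)) q, Finset.mul_sum]
    refine Finset.sum_congr rfl fun δ _ => by ring
  -- `ε` is already alternating in its last two slots, so antisymmetrizing `F` changes nothing.
  have hswap : ∑ γ, ∑ δ, T (b γ) (b δ) * F δ γ = -∑ γ, ∑ δ, T (b γ) (b δ) * F γ δ := by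
    rw [Finset.sum_comm, ← Finset.sum_neg_distrib]
    refine Finset.sum_congr rfl fun γ _ => ?_
    rw [← Finset.sum_neg_distrib]
    refine Finset.sum_congr rfl fun δ _ => ?_
    rw [hTs]; ring
  have hhalf : ∑ γ, ∑ δ, T (b γ) (b δ) * ((F γ δ - F δ γ) / 2)
      = ∑ γ, ∑ δ, T (b γ) (b δ) * F γ δ := by
    have : ∀ γ δ, T (b γ) (b δ) * ((F γ δ - F δ γ) / 2)
      = (T (b γ) (b δ) * F γ δ - T (b γ) (b δ) * F δ γ) / 2 := fun _ _ => by ring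
    simp only [this, ← Finset.sum_div, Finset.sum_sub_distrib, hswap]
    ring
  rw [hhalf]
  have h3 : ∑ γ, ∑ δ, T (b γ) (b δ) * ∑ i, b.coord γ (A (e i)) * b.coord δ (e i)
      = ∑ i, T (A (e i)) (e i) := by
    simp_rw [← hcon (A (e _)) (e _), Finset.mul_sum]
    rw [Finset.sum_comm' (t' := Finset.univ) (s' := fun _ => Finset.univ) (by simp),
      Finset.sum_comm]
    conv_lhs =>
      enter [2, γ]
      rw [Finset.sum_comm]
    rw [Finset.sum_comm]
  simp only [hex, mul_add, mul_sub, mul_neg, Finset.sum_add_distrib, Finset.sum_sub_distrib,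
    Finset.sum_neg_distrib, hcon, h3]
  ring

theorem volume_sq {e : Fin 2 → V} (h : IsNullFrame B n w e) {ε : V [⋀^Fin 4]→ₗ[ℝ] ℝ}
    (hε : ∀ v : Fin 4 → V, ε v ^ 2 = -(Matrix.of fun i j => B (v i) (v j)).det) :
    ε ![w, n, e 0, e 1] ^ 2 = 1 := by
  rw [hε, Matrix.det_succ_row_zero]
  simp [Fin.sum_univ_succ, Matrix.det_succ_row_zero, Matrix.submatrix, Fin.succAbove, h.nn, h.ww,
    h.nw, h.symm w n, h.ne, h.we, h.ee, h.symm (e _) n, h.symm (e _) w]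

variable {e : Fin 2 → V} {A : V →ₗ[ℝ] V} (h : IsNullFrame B n w e)
  (hA : ∀ u v, B (A u) v + B (A v) u = 0) (hn : A n = 0)

include h hA hn

/-- Of the frame sum only `ε(u, n, A e_i, e_i)` survives, since `A n = 0` and `n` may not occur
twice. There `A e_i` counts only through its component along the other `e_j`, and `u` only through
`-(B n u) w`. Both values of `i` give the same term, whence the factor 4. -/
theorem contractTwist_eq_smul {ι : Type*} [Fintype ι] [DecidableEq ι]
    (b : Module.Basis ι ℝ V) (ε : V [⋀^Fin 4]→ₗ[ℝ] ℝ) (u : V) :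
    contractTwist B b A n ε u =
      4 * B (A (e 0)) (e 1) * ε ![w, n, e 0, e 1] * B n u := by
  have hr := apply_right_null hA hn
  rw [h.contractTwist_eq]
  simp only [← curryFour_apply]
  set T := curryFour ε with hT
  have z02 : ∀ a c d, T a c a d = 0 := fun a c d => ε.map_eq_zero_of_eq _
    (i := 0) (j := 2) rfl (by decide)
  have z01 : ∀ a c d, T a a c d = 0 := fun a c d => ε.map_eq_zero_of_eq _
    (i := 0) (j := 1) rfl (by decide)
  have z12 : ∀ a c d, T a c c d = 0 := fun a c d => ε.map_eq_zero_of_eq _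
    (i := 1) (j := 2) rfl (by decide)
  have z13 : ∀ a c d, T a c d c = 0 := fun a c d => ε.map_eq_zero_of_eq _
    (i := 1) (j := 3) rfl (by decide)
  have z23 : ∀ a c d, T a c d d = 0 := fun a c d => ε.map_eq_zero_of_eq _
    (i := 2) (j := 3) rfl (by decide)
  have z03 : ∀ a c d, T a c d a = 0 := fun a c d => ε.map_eq_zero_of_eq _
    (i := 0) (j := 3) rfl (by decide)
  have hd : ∀ i, B (A (e i)) (e i) = 0 := fun i => by linarith [hA (e i) (e i)]
  have hu : T u n (e 0) (e 1) = -(B n u) * T w n (e 0) (e 1) := by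
    conv_lhs => rw [h.expand u]
    simp only [Fin.sum_univ_two, map_add, map_sub, map_smul, LinearMap.add_apply,
      LinearMap.sub_apply, LinearMap.smul_apply, smul_eq_mul, z01, z02, z03, neg_smul, map_neg,
      LinearMap.neg_apply]
    ring
  have h0 : T u n (A (e 0)) (e 0) = B (A (e 0)) (e 1) * (B n u * T w n (e 0) (e 1)) := by
    conv_lhs => rw [h.expand (A (e 0))]
    simp only [Fin.sum_univ_two, map_add, map_sub, map_smul, LinearMap.add_apply,
      LinearMap.sub_apply, LinearMap.smul_apply, smul_eq_mul, z12, z23, neg_smul, map_neg,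
      LinearMap.neg_apply, h.symm n (A _), hr]
    rw [curryFour_swap₂₃ ε u n (e 1) (e 0), ← hT, hu, h.symm (e 1)]
    simp
  have h1 : T u n (A (e 1)) (e 1) = B (A (e 0)) (e 1) * (B n u * T w n (e 0) (e 1)) := by
    have : B (A (e 1)) (e 0) = -B (A (e 0)) (e 1) := by linarith [hA (e 0) (e 1)]
    conv_lhs => rw [h.expand (A (e 1))]
    simp only [Fin.sum_univ_two, map_add, map_sub, map_smul, LinearMap.add_apply,
      LinearMap.sub_apply, LinearMap.smul_apply, smul_eq_mul, z12, z23, neg_smul, map_neg,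
      LinearMap.neg_apply, h.symm n (A _), hr, hu, h.symm (e 0) (A _), this]
    simp
  rw [Fin.sum_univ_two, h0, h1, hn, z13]
  simp only [map_zero, LinearMap.zero_apply]
  ring

/-- Modulo terms divisible by `n`, the 2-form of `A` is its single transverse entry times `e₀ ∧ e₁`.
So both sides are multiples of `n ∧ e₀ ∧ e₁`, and `hε` fixes the ratio. -/
theorem wedge_eq_smul_volume {ε : V [⋀^Fin 4]→ₗ[ℝ] ℝ}
    (hε : ε ![w, n, e 0, e 1] ^ 2 = 1) (p q r : V) :
    B n p * (2 * B (A q) r) + B n q * (2 * B (A r) p) + B n r * (2 * B (A p) q) =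
      2 * B (A (e 0)) (e 1) * ε ![w, n, e 0, e 1] * ε ![n, p, q, r] := by
  have hr := apply_right_null hA hn
  simp only [← curryFour_apply] at hε ⊢
  set T := curryFour ε with hT
  have z01 : ∀ a c d, T a a c d = 0 := fun a c d => ε.map_eq_zero_of_eq _
    (i := 0) (j := 1) rfl (by decide)
  have z02 : ∀ a c d, T a c a d = 0 := fun a c d => ε.map_eq_zero_of_eq _
    (i := 0) (j := 2) rfl (by decide)
  have z03 : ∀ a c d, T a c d a = 0 := fun a c d => ε.map_eq_zero_of_eq _
    (i := 0) (j := 3) rfl (by decide)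
  have z12 : ∀ a c d, T a c c d = 0 := fun a c d => ε.map_eq_zero_of_eq _
    (i := 1) (j := 2) rfl (by decide)
  have z13 : ∀ a c d, T a c d c = 0 := fun a c d => ε.map_eq_zero_of_eq _
    (i := 1) (j := 3) rfl (by decide)
  have z23 : ∀ a c d, T a c d d = 0 := fun a c d => ε.map_eq_zero_of_eq _
    (i := 2) (j := 3) rfl (by decide)
  have hd : ∀ v, B (A v) v = 0 := fun v => by linarith [hA v v]
  have hε' : T w n (e 0) (e 1) * T n w (e 0) (e 1) = -1 := by
    rw [curryFour_swap₀₁ ε n w, ← hT]; linarith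
  have hexp : ∀ q r, B (A q) r =
      -(B n q * B (e 0) r - B n r * B (e 0) q) * B (A w) (e 0)
      - (B n q * B (e 1) r - B n r * B (e 1) q) * B (A w) (e 1)
      + (B (e 0) q * B (e 1) r - B (e 0) r * B (e 1) q) * B (A (e 0)) (e 1) := by
    intro q r
    conv_lhs => rw [h.expand q, h.expand r]
    have s0 : B (A (e 0)) w = -B (A w) (e 0) := by linarith [hA w (e 0)]
    have s1 : B (A (e 1)) w = -B (A w) (e 1) := by linarith [hA w (e 1)]
    have s2 : B (A (e 1)) (e 0) = -B (A (e 0)) (e 1) := by linarith [hA (e 0) (e 1)]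
    simp only [Fin.sum_univ_two, map_add, map_sub, map_smul, LinearMap.add_apply,
      LinearMap.sub_apply, LinearMap.smul_apply, smul_eq_mul, neg_smul, map_neg,
      LinearMap.neg_apply, hr, hn, hd, s0, s1, s2, map_zero, LinearMap.zero_apply]
    ring
  have hvol : T n p q r = (-(B n p * (B (e 0) q * B (e 1) r - B (e 0) r * B (e 1) q))
      - B n q * (B (e 0) r * B (e 1) p - B (e 0) p * B (e 1) r)
      - B n r * (B (e 0) p * B (e 1) q - B (e 0) q * B (e 1) p)) * T n w (e 0) (e 1) := by
    conv_lhs => rw [h.expand p, h.expand q, h.expand r]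
    have p1 : T n w (e 1) (e 0) = -T n w (e 0) (e 1) := curryFour_swap₂₃ ..
    have p2 : T n (e 0) w (e 1) = -T n w (e 0) (e 1) := curryFour_swap₁₂ ..
    have p3 : T n (e 1) w (e 0) = T n w (e 0) (e 1) := by
      rw [hT, curryFour_swap₁₂, ← hT, p1, neg_neg]
    have p4 : T n (e 0) (e 1) w = T n w (e 0) (e 1) := by
      rw [hT, curryFour_swap₂₃, ← hT, p2, neg_neg]
    have p5 : T n (e 1) (e 0) w = -T n w (e 0) (e 1) := by
      rw [hT, curryFour_swap₂₃, ← hT, p3]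
    simp only [Fin.sum_univ_two, map_add, map_sub, map_smul, LinearMap.add_apply,
      LinearMap.sub_apply, LinearMap.smul_apply, smul_eq_mul, neg_smul, map_neg,
      LinearMap.neg_apply, z01, z02, z03, z12, z13, z23, p1, p2, p3, p4, p5]
    ring
  rw [hvol, hexp q r, hexp r p, hexp p q]
  linear_combination (-2 * B (A (e 0)) (e 1)) *
    (-(B n p * (B (e 0) q * B (e 1) r - B (e 0) r * B (e 1) q))
      - B n q * (B (e 0) r * B (e 1) p - B (e 0) p * B (e 1) r)
      - B n r * (B (e 0) p * B (e 1) q - B (e 0) q * B (e 1) p)) * hε'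

end IsNullFrame

/-- In four dimensions, the twist covector of a skew endomorphism `A` annihilating the null vector
`n` is a multiple of `n`, and so is the 3-form `n ∧ A` of the contraction of the volume form with
`n`. -/
theorem exists_twist_factor [FiniteDimensional ℝ V] (hdim : Module.finrank ℝ V = 4)
    (B : V →ₗ[ℝ] V →ₗ[ℝ] ℝ) (symm : ∀ u v, B u v = B v u)
    (lor : ∃ t, B t t < 0 ∧ ∀ v, B t v = 0 → v ≠ 0 → 0 < B v v) {n : V} (hn0 : n ≠ 0)
    (nn : B n n = 0) {A : V →ₗ[ℝ] V} (hA : ∀ u v, B (A u) v + B (A v) u = 0) (hn : A n = 0)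
    {ι : Type*} [Fintype ι] [DecidableEq ι] (b : Module.Basis ι ℝ V)
    {ε : V [⋀^Fin 4]→ₗ[ℝ] ℝ}
    (hε : ∀ v : Fin 4 → V, ε v ^ 2 = -(Matrix.of fun i j => B (v i) (v j)).det) :
    ∃ c : ℝ, c ^ 2 = 8 * -LinearMap.trace ℝ V (A ∘ₗ A) ∧
      (∀ u, contractTwist B b A n ε u = c * B n u) ∧
      (∀ p q r, B n p * (2 * B (A q) r) + B n q * (2 * B (A r) p) + B n r * (2 * B (A p) q) =
        c / 2 * ε ![n, p, q, r]) ∧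
      (∃ u, B n u ≠ 0) ∧ ∃ p q r, ε ![n, p, q, r] ≠ 0 := by
  obtain ⟨w, k, e, h⟩ := exists_isNullFrame B symm lor hn0 nn
  obtain rfl : k = 2 := by have := h.finrank_eq; omega
  have hv := h.volume_sq hε
  -- With `a = B (A (e 0)) (e 1)`, the volume factor squares to 1 and the trace term is `2 a ^ 2`,
  -- so `c ^ 2 = 16 a ^ 2` is 8 times it.
  refine ⟨4 * B (A (e 0)) (e 1) * ε ![w, n, e 0, e 1], ?_, h.contractTwist_eq_smul hA hn b ε,
    fun p q r => ?_, ⟨w, by simp [h.nw]⟩, w, e 0, e 1, fun h0 => ?_⟩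
  · have hd : ∀ v, B (A v) v = 0 := fun v => by linarith [hA v v]
    have s2 : B (A (e 1)) (e 0) = -B (A (e 0)) (e 1) := by linarith [hA (e 0) (e 1)]
    rw [h.neg_trace_sq hA hn, mul_pow, hv]
    simp only [Fin.sum_univ_two, hd, s2]
    ring
  · rw [h.wedge_eq_smul_volume hA hn hv]
    ring
  · have := curryFour_swap₀₁ ε w n (e 0) (e 1)
    simp only [curryFour_apply, h0] at this
    simp [this] at hv

end FourDimensional

/-! ### Killing calculus in coordinates and the Ricci identity -/

section CoordinateCalculus

/-- Under the identification of `V` with its dual by `B`, `A` becomes minus its transpose, which has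
the trace of `A` up to sign. -/
theorem trace_eq_zero_of_skew {V : Type*} [AddCommGroup V] [Module ℝ V] [FiniteDimensional ℝ V]
    (B : V →ₗ[ℝ] V →ₗ[ℝ] ℝ) (symm : ∀ u v, B u v = B v u) (nondeg : ∀ u, (∀ v, B u v = 0) → u = 0)
    (A : V →ₗ[ℝ] V) (hA : ∀ u v, B (A u) v + B (A v) u = 0) : LinearMap.trace ℝ V A = 0 := by
  have hinj : Function.Injective B := by
    rw [injective_iff_map_eq_zero]
    intro u hu
    exact nondeg u fun v => by rw [hu]; rfl
  let φ : V ≃ₗ[ℝ] Module.Dual ℝ V :=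
    LinearEquiv.ofInjectiveOfFinrankEq B hinj Subspace.dual_finrank_eq.symm
  have h : φ.conj A = -Module.Dual.transpose (R := ℝ) A := by
    ext f v
    obtain ⟨u, rfl⟩ := φ.surjective f
    have h1 : φ.conj A (φ u) = φ (A u) := by simp [LinearEquiv.conj_apply]
    rw [h1]
    change B (A u) v = -(B u (A v))
    rw [symm u]
    linarith [hA u v]
  have h2 := LinearMap.trace_conj' A φ
  rw [h, map_neg, LinearMap.trace_transpose'] at h2
  linarith

variable {E : Type*} [NormedAddCommGroup E] [NormedSpace ℝ E]

@[simp]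
theorem covDeriv_apply (G : E → E →L[ℝ] E →L[ℝ] ℝ) (N : E → E) (y u : E) :
    covDeriv G N y u = fderiv ℝ N y u + christoffel G y u (N y) := rfl

/-- `N` is a lightlike Killing field of the pseudo-Riemannian metric `G` on the open set `O`. -/
structure IsLightlikeKillingOn (G : E → E →L[ℝ] E →L[ℝ] ℝ) (N : E → E) (O : Set E) : Prop where
  isOpen : IsOpen O
  contDiffOn_metric : ContDiffOn ℝ 2 G O
  contDiffOn_field : ContDiffOn ℝ 2 N O
  symm : ∀ y ∈ O, ∀ u v, G y u v = G y v u
  nondeg : ∀ y ∈ O, ∀ u, (∀ v, G y u v = 0) → u = 0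
  lightlike : ∀ y ∈ O, G y (N y) (N y) = 0
  killing : ∀ y ∈ O, ∀ u v, G y (covDeriv G N y u) v + G y (covDeriv G N y v) u = 0

theorem isInvertible_of_nondegenerate [FiniteDimensional ℝ E] (B : E →L[ℝ] E →L[ℝ] ℝ)
    (nondeg : ∀ u, (∀ v, B u v = 0) → u = 0) : B.IsInvertible := by
  have hinj : Function.Injective B.toLinearMap := by
    rw [injective_iff_map_eq_zero]
    intro u hu
    exact nondeg u fun v => DFunLike.congr_fun hu v
  have hr : Module.finrank ℝ E = Module.finrank ℝ (E →L[ℝ] ℝ) := by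
    rw [← (LinearMap.toContinuousLinearMap (𝕜 := ℝ) (E := E) (F' := ℝ)).finrank_eq]
    exact Subspace.dual_finrank_eq.symm
  exact ⟨(LinearEquiv.ofInjectiveOfFinrankEq B.toLinearMap hinj hr).toContinuousLinearEquiv,
    by ext; rfl⟩

theorem contDiffAt_christoffel [CompleteSpace E] {G : E → E →L[ℝ] E →L[ℝ] ℝ} {y : E}
    (hG : ContDiffAt ℝ 2 G y) (hy : (G y).IsInvertible) : ContDiffAt ℝ 1 (christoffel G) y := by
  have hD : ContDiffAt ℝ 1 (fderiv ℝ G) y := hG.fderiv_right (by norm_num)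
  have hDf : ContDiffAt ℝ 1 (fun y => (fderiv ℝ G y).flip) y :=
    (ContinuousLinearMap.flipₗᵢ ℝ E E (E →L[ℝ] ℝ)).contDiff.contDiffAt.comp y hD
  have hL : ContDiffAt ℝ 1 (christoffelLower G) y :=
    ((hD.add hDf).sub (contDiffAt_const.clm_comp hDf)).const_smul (1 / 2 : ℝ)
  have hI : ContDiffAt ℝ 1 (fun y => (G y).inverse) y := by
    obtain ⟨e, he⟩ := hy
    have := contDiffAt_map_inverse (𝕜 := ℝ) (n := 1) e
    rw [he] at this
    exact this.comp y (hG.of_le (by norm_num))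
  exact ((ContinuousLinearMap.compL ℝ E (E →L[ℝ] ℝ) E).contDiff.contDiffAt.comp y hI).clm_comp hL

namespace IsLightlikeKillingOn

variable [FiniteDimensional ℝ E] {G : E → E →L[ℝ] E →L[ℝ] ℝ} {N : E → E} {O : Set E}
  (h : IsLightlikeKillingOn G N O) {y : E} (hy : y ∈ O)

include h hy

omit [FiniteDimensional ℝ E] in
theorem contDiffAt_metric : ContDiffAt ℝ 2 G y :=
  h.contDiffOn_metric.contDiffAt (h.isOpen.mem_nhds hy)

omit [FiniteDimensional ℝ E] in
theorem contDiffAt_field : ContDiffAt ℝ 2 N y :=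
  h.contDiffOn_field.contDiffAt (h.isOpen.mem_nhds hy)

omit [FiniteDimensional ℝ E] in
theorem differentiableAt_metric : DifferentiableAt ℝ G y :=
  (h.contDiffAt_metric hy).differentiableAt (by norm_num)

omit [FiniteDimensional ℝ E] in
theorem differentiableAt_field : DifferentiableAt ℝ N y :=
  (h.contDiffAt_field hy).differentiableAt (by norm_num)

omit [FiniteDimensional ℝ E] in
theorem fderiv_symm (u v w : E) : fderiv ℝ G y u v w = fderiv ℝ G y u w v := by
  have hd := (h.differentiableAt_metric hy).hasFDerivAt
  have h1 := (hd.clm_apply (hasFDerivAt_const v y)).clm_apply (hasFDerivAt_const w y)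
  have h2 := (hd.clm_apply (hasFDerivAt_const w y)).clm_apply (hasFDerivAt_const v y)
  have h3 := h1.congr_of_eventuallyEq (f₁ := fun y => G y w v) (by
    filter_upwards [h.isOpen.mem_nhds hy] with z hz using h.symm z hz w v)
  simpa using DFunLike.congr_fun (h3.unique h2) u

theorem metric_christoffel (u v w : E) :
    G y (christoffel G y u v) w = christoffelLower G y u v w := by
  obtain ⟨e, he⟩ := isInvertible_of_nondegenerate _ (h.nondeg y hy)
  rw [christoffel_apply, ← he, ContinuousLinearMap.inverse_equiv]
  simp

omit [FiniteDimensional ℝ E] in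
theorem christoffel_symm (u v : E) : christoffel G y u v = christoffel G y v u := by
  rw [christoffel_apply, christoffel_apply]
  congr 1
  ext w
  rw [christoffelLower_apply, christoffelLower_apply, h.fderiv_symm hy w u v]
  ring

/-- Metric compatibility of the connection: in the sum of the two lowered Christoffel symbols all
other derivatives cancel. -/
theorem fderiv_metric (u v w : E) :
    fderiv ℝ G y u v w = G y (christoffel G y u v) w + G y (christoffel G y u w) v := by
  rw [h.metric_christoffel hy, h.metric_christoffel hy, christoffelLower_apply,
    christoffelLower_apply, h.fderiv_symm hy u w v, h.fderiv_symm hy v u w,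
    h.fderiv_symm hy w u v]
  ring

/-- This is the derivative of `G(N, N) = 0`, rewritten by metric compatibility. -/
theorem metric_covDeriv_field (u : E) : G y (covDeriv G N y u) (N y) = 0 := by
  have hd := (h.differentiableAt_metric hy).hasFDerivAt
  have hN := (h.differentiableAt_field hy).hasFDerivAt
  have h1 := (hd.clm_apply hN).clm_apply hN
  have h2 := h1.congr_of_eventuallyEq (f₁ := fun _ => (0 : ℝ)) (by
    filter_upwards [h.isOpen.mem_nhds hy] with z hz using (h.lightlike z hz).symm)
  have h3 := DFunLike.congr_fun (h2.unique (hasFDerivAt_const (0 : ℝ) y)) u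
  simp only [add_apply, ContinuousLinearMap.flip_apply, zero_apply,
    ContinuousLinearMap.comp_apply] at h3
  rw [h.fderiv_metric hy, h.symm y hy (N y)] at h3
  simp only [covDeriv_apply, map_add, add_apply]
  linarith

theorem covDeriv_field : covDeriv G N y (N y) = 0 := by
  refine h.nondeg y hy _ fun v => ?_
  have := h.killing y hy v (N y)
  rwa [h.metric_covDeriv_field hy, zero_add] at this

theorem trace_covDeriv : LinearMap.trace ℝ E (covDeriv G N y).toLinearMap = 0 :=
  trace_eq_zero_of_skew ((ContinuousLinearMap.coeLM ℝ) ∘ₗ (G y).toLinearMap) (h.symm y hy)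
    (h.nondeg y hy) _ (h.killing y hy)

theorem isInvertible_metric : (G y).IsInvertible :=
  isInvertible_of_nondegenerate _ (h.nondeg y hy)

theorem differentiableAt_christoffel : DifferentiableAt ℝ (christoffel G) y :=
  have := FiniteDimensional.complete ℝ E
  (contDiffAt_christoffel (h.contDiffAt_metric hy) (h.isInvertible_metric hy)).differentiableAt
    (by norm_num)

omit [FiniteDimensional ℝ E] in
theorem differentiableAt_fderiv_field : DifferentiableAt ℝ (fderiv ℝ N) y :=
  ((h.contDiffAt_field hy).fderiv_right (m := 1) (by norm_num)).differentiableAt (by norm_num)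

theorem differentiableAt_covDeriv : DifferentiableAt ℝ (covDeriv G N) y :=
  (h.differentiableAt_fderiv_field hy).add
    (((ContinuousLinearMap.flipₗᵢ ℝ E E E).differentiableAt.comp y
      (h.differentiableAt_christoffel hy)).clm_apply (h.differentiableAt_field hy))

theorem fderiv_covDeriv_apply (u v : E) :
    fderiv ℝ (covDeriv G N) y u v = fderiv ℝ (fderiv ℝ N) y u v +
      fderiv ℝ (christoffel G) y u v (N y) + christoffel G y v (fderiv ℝ N y u) := by
  have h1 := (h.differentiableAt_covDeriv hy).hasFDerivAt.clm_apply (hasFDerivAt_const v y)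
  have h2 := ((h.differentiableAt_fderiv_field hy).hasFDerivAt.clm_apply
    (hasFDerivAt_const v y)).add (((h.differentiableAt_christoffel hy).hasFDerivAt.clm_apply
      (hasFDerivAt_const v y)).clm_apply (h.differentiableAt_field hy).hasFDerivAt)
  have h3 := DFunLike.congr_fun (h1.unique h2) u
  simp only [add_apply, ContinuousLinearMap.flip_apply, zero_apply, map_zero,
    ContinuousLinearMap.comp_apply, zero_add] at h3
  rw [h3]
  abel

omit [FiniteDimensional ℝ E] in
theorem differentiableAt_lower : DifferentiableAt ℝ (lower G N) y :=
  (ContinuousAlternatingMap.ofSubsingletonLIE (𝕜 := ℝ) (E := E) (F := ℝ) (0 : Fin 1)).differentiableAt.comp y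
    ((h.differentiableAt_metric hy).clm_apply (h.differentiableAt_field hy))

/-- The Christoffel terms cancel by symmetry (no torsion), and the Killing equation makes the two
remaining terms equal. -/
theorem extDeriv_lower (u v : E) :
    extDeriv (lower G N) y ![u, v] = 2 * G y (covDeriv G N y u) v := by
  have key : ∀ v u : E, fderiv ℝ (fun z => G z (N z) v) y u =
      G y (covDeriv G N y u) v + G y (christoffel G y u v) (N y) := by
    intro v u
    have h1 := (((h.differentiableAt_metric hy).hasFDerivAt.clm_apply
      (h.differentiableAt_field hy).hasFDerivAt).clm_apply (hasFDerivAt_const v y)).fderiv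
    rw [h1]
    simp only [add_apply, ContinuousLinearMap.flip_apply, zero_apply, map_zero,
      ContinuousLinearMap.comp_apply, zero_add, covDeriv_apply, map_add, h.fderiv_metric hy]
    ring
  rw [extDeriv_apply (h.differentiableAt_lower hy), Fin.sum_univ_two]
  have e0 : (fun z => lower G N z ((0 : Fin 2).removeNth ![u, v])) = fun z => G z (N z) v := rfl
  have e1 : (fun z => lower G N z ((1 : Fin 2).removeNth ![u, v])) = fun z => G z (N z) u := rfl
  rw [e0, e1]
  simp only [Matrix.cons_val_zero, Matrix.cons_val_one, key, h.christoffel_symm hy v u]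
  have := h.killing y hy u v
  simp only [Fin.val_zero, Fin.val_one, pow_zero, pow_one, one_smul, neg_smul]
  linarith

/-- The contracted Ricci identity for a lightlike Killing field. -/
theorem ricci_eq : ricci G y (N y) (N y) =
    -LinearMap.trace ℝ E ((covDeriv G N y).toLinearMap ∘ₗ (covDeriv G N y).toLinearMap) := by
  set A := (covDeriv G N y).toLinearMap with hA
  set C : E →ₗ[ℝ] E := (christoffel G y (N y)).toLinearMap with hC
  have hcov := (h.differentiableAt_covDeriv hy).hasFDerivAt
  -- Differentiate `A N = 0`, which holds on all of `O`.
  have h1 : ∀ u, fderiv ℝ (covDeriv G N) y u (N y) = -A (fderiv ℝ N y u) := by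
    intro u
    have h2 := hcov.clm_apply (h.differentiableAt_field hy).hasFDerivAt
    have h3 := h2.congr_of_eventuallyEq (f₁ := fun _ => (0 : E)) (by
      filter_upwards [h.isOpen.mem_nhds hy] with z hz using (h.covDeriv_field hz).symm)
    have h4 := DFunLike.congr_fun (h3.unique (hasFDerivAt_const (0 : E) y)) u
    simp only [add_apply, ContinuousLinearMap.flip_apply, zero_apply,
      ContinuousLinearMap.comp_apply] at h4
    exact eq_neg_of_add_eq_zero_right h4
  -- Differentiate `tr A = 0` along `N`.
  have h2 : LinearMap.trace ℝ E (fderiv ℝ (covDeriv G N) y (N y)).toLinearMap = 0 := by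
    let T : (E →L[ℝ] E) →L[ℝ] ℝ := LinearMap.toContinuousLinearMap
      (LinearMap.trace ℝ E ∘ₗ ContinuousLinearMap.coeLM ℝ)
    have h3 := (T.hasFDerivAt.comp y hcov).congr_of_eventuallyEq (f₁ := fun _ => (0 : ℝ)) (by
      filter_upwards [h.isOpen.mem_nhds hy] with z hz using (h.trace_covDeriv hz).symm)
    exact DFunLike.congr_fun (h3.unique (hasFDerivAt_const (0 : ℝ) y)) (N y)
  have hsymm : ∀ u v, fderiv ℝ (fderiv ℝ N) y u v = fderiv ℝ (fderiv ℝ N) y v u :=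
    (h.contDiffAt_field hy).isSymmSndFDerivAt (by simp)
  have hDN : ∀ u, fderiv ℝ N y u = A u - C u := by
    intro u
    simp [hA, hC, h.christoffel_symm hy (N y) u]
  have hAN : A (N y) = 0 := h.covDeriv_field hy
  -- The second derivatives of `N` cancel by symmetry. What the partial derivatives leave of the
  -- connection is the commutator of `A` and `C`, which has no trace.
  have hR : ∀ u, riemann G y u (N y) (N y) = -A (A u) + A (C u) - C (A u)
      - fderiv ℝ (covDeriv G N) y (N y) u := by
    intro u
    have e1 := h.fderiv_covDeriv_apply hy u (N y)
    have e2 := h.fderiv_covDeriv_apply hy (N y) u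
    rw [h1, hDN, map_sub, map_sub] at e1
    rw [hDN, hAN, zero_sub, map_neg, hsymm] at e2
    have e3 : ∀ v, christoffel G y (N y) v = C v := fun _ => rfl
    simp only [e3] at e1 e2
    simp only [riemann, e3, h.christoffel_symm hy u (N y)]
    linear_combination (norm := module) (1 : ℝ) • e2 - (1 : ℝ) • e1
  have hL : ricci G y (N y) (N y) = LinearMap.trace ℝ E
      (-(A ∘ₗ A) + A ∘ₗ C - C ∘ₗ A - (fderiv ℝ (covDeriv G N) y (N y)).toLinearMap) := by
    unfold ricci
    congr 1
    ext u
    exact hR u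
  rw [hL, map_sub, map_sub, map_add, map_neg, h2, LinearMap.trace_comp_comm' A C]
  ring

end IsLightlikeKillingOn

end CoordinateCalculus

/-! ### Passing between the manifold and its charts -/

section Charts

variable {E : Type*} [NormedAddCommGroup E] [NormedSpace ℝ E]
  {M : Type*} [TopologicalSpace M] [ChartedSpace E M] [IsManifold 𝓘(ℝ, E) 3 M]

theorem coord_eq_id (x : M) : coord (E := E) x = ContinuousLinearMap.id ℝ E :=
  mfderiv_extChartAt_self (I := 𝓘(ℝ, E)) (x := x)

theorem frame_self (x : M) :
    frame (E := E) x (extChartAt 𝓘(ℝ, E) x x) = ContinuousLinearMap.id ℝ E := by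
  have := mfderivWithin_range_extChartAt_symm (I := 𝓘(ℝ, E)) (x := x)
  rwa [modelWithCornersSelf_coe, Set.range_id, mfderivWithin_univ] at this

theorem isInvertible_frame {c : M} {y : E} (hy : y ∈ (extChartAt 𝓘(ℝ, E) c).target) :
    (frame (E := E) c y).IsInvertible := by
  have := isInvertible_mfderivWithin_extChartAt_symm hy
  rwa [modelWithCornersSelf_coe, Set.range_id, mfderivWithin_univ] at this

theorem frame_fieldInChart (n : ∀ x : M, TangentSpace 𝓘(ℝ, E) x) {c : M} {y : E}
    (hy : y ∈ (extChartAt 𝓘(ℝ, E) c).target) :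
    frame c y (fieldInChart n c y) = n ((extChartAt 𝓘(ℝ, E) c).symm y) :=
  (isInvertible_frame hy).self_apply_inverse _

theorem fieldInChart_self (n : ∀ x : M, TangentSpace 𝓘(ℝ, E) x) (x : M) :
    fieldInChart n x (extChartAt 𝓘(ℝ, E) x x) = n x := by
  have h := frame_fieldInChart n (mem_extChartAt_target (I := 𝓘(ℝ, E)) x)
  rw [frame_self] at h
  -- The base point is `x` only up to a propositional equality, so it is generalized before
  -- substitution.
  have h2 : ∀ z, z = x → (n z : E) = n x := by rintro z rfl; rfl
  exact h.trans (h2 _ (extChartAt_to_inv x))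

theorem LorentzMetric.inChart_self (g : LorentzMetric E M) (x : M) (u v : E) :
    g.inChart x (extChartAt 𝓘(ℝ, E) x x) u v = g.form x u v := by
  rw [g.inChart_apply, frame_self]
  have h2 : ∀ z, z = x → (g.form z : E → E →L[ℝ] ℝ) u v = g.form x u v := by rintro z rfl; rfl
  exact h2 _ (extChartAt_to_inv x)

theorem LorentzMetric.eq_zero_of_form_eq_zero (g : LorentzMetric E M) (x : M)
    (u : TangentSpace 𝓘(ℝ, E) x) (h : ∀ v, g.form x u v = 0) : u = 0 := by
  obtain ⟨t, -, ht⟩ := g.lorentzian x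
  by_contra h0
  exact (ht u (by rw [g.symm]; exact h t) h0).ne' (h u)

/-- The tangent map of the `C³` inverse chart, applied to a constant field; one derivative is lost.
-/
theorem contMDiffAt_frame (c : M) {y : E} (hy : y ∈ (extChartAt 𝓘(ℝ, E) c).target) (u : E) :
    ContMDiffAt 𝓘(ℝ, E) 𝓘(ℝ, E).tangent 2
      (fun z => (⟨(extChartAt 𝓘(ℝ, E) c).symm z, frame c z u⟩ : TangentBundle 𝓘(ℝ, E) M)) y := by
  have ho := isOpen_extChartAt_target (I := 𝓘(ℝ, E)) c
  have h1 := (contMDiffOn_extChartAt_symm (I := 𝓘(ℝ, E)) (n := 3) c).contMDiffOn_tangentMapWithin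
    (m := 2) (by norm_num) ho.uniqueMDiffOn
  have h2 : ContMDiff 𝓘(ℝ, E) 𝓘(ℝ, E).tangent 2
      (fun z => (⟨z, u⟩ : TangentBundle 𝓘(ℝ, E) E)) :=
    contMDiff_vectorSpace_iff_contDiff.2 contDiff_const
  have h3 := h1.comp (h2.contMDiffOn (s := (extChartAt 𝓘(ℝ, E) c).target)) (fun z hz => hz)
  refine (h3.contMDiffAt (ho.mem_nhds hy)).congr_of_eventuallyEq ?_
  filter_upwards [ho.mem_nhds hy] with z hz
  simp only [Function.comp_apply, tangentMapWithin, frame,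
    mfderivWithin_of_mem_nhds (ho.mem_nhds hz)]
  rfl

variable [FiniteDimensional ℝ E]

theorem LorentzMetric.contDiffOn_inChart (g : LorentzMetric E M) (c : M) :
    ContDiffOn ℝ 2 (g.inChart c) (extChartAt 𝓘(ℝ, E) c).target := by
  rw [contDiffOn_clm_apply]
  intro u
  rw [contDiffOn_clm_apply]
  intro v y hy
  refine ContDiffAt.contDiffWithinAt ?_
  rw [← contMDiffAt_iff_contDiffAt]
  have hs : ContMDiffAt 𝓘(ℝ, E) 𝓘(ℝ, E) 2 (extChartAt 𝓘(ℝ, E) c).symm y :=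
    ((contMDiffOn_extChartAt_symm (I := 𝓘(ℝ, E)) (n := 3) c).contMDiffAt
      ((isOpen_extChartAt_target c).mem_nhds hy)).of_le (by norm_num)
  have : ContMDiffAt 𝓘(ℝ, E) (𝓘(ℝ, E).prod 𝓘(ℝ)) 2
      (fun z => Bundle.TotalSpace.mk' ℝ (E := Bundle.Trivial M ℝ) ((extChartAt 𝓘(ℝ, E) c).symm z)
        (g.form ((extChartAt 𝓘(ℝ, E) c).symm z) (frame c z u) (frame c z v))) y := by
    apply ContMDiffAt.clm_bundle_apply₂ (F₁ := E) (F₂ := E)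
    · exact g.contMDiff.contMDiffAt.comp y hs
    · exact contMDiffAt_frame c hy u
    · exact contMDiffAt_frame c hy v
  simp only [Bundle.contMDiffAt_totalSpace] at this
  exact this.2

theorem contDiffOn_fieldInChart {n : ∀ x : M, TangentSpace 𝓘(ℝ, E) x}
    (hn : ContMDiff 𝓘(ℝ, E) 𝓘(ℝ, E).tangent 2 (fun x => (⟨x, n x⟩ : TangentBundle 𝓘(ℝ, E) M)))
    (c : M) : ContDiffOn ℝ 2 (fieldInChart n c) (extChartAt 𝓘(ℝ, E) c).target := by
  intro y hy
  have := FiniteDimensional.complete ℝ E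
  refine ContDiffAt.contDiffWithinAt ?_
  have h := ContMDiffAt.mpullback_vectorField_preimage (n := 3) (m := 2) (V := n) hn.contMDiffAt
    ((contMDiffOn_extChartAt_symm (I := 𝓘(ℝ, E)) (n := 3) c).contMDiffAt
      ((isOpen_extChartAt_target c).mem_nhds hy)) (isInvertible_frame (E := E) hy) (by norm_num)
  exact contMDiffAt_vectorSpace_iff_contDiffAt.1 h

theorem LorentzMetric.IsLightlikeKilling.isLightlikeKillingOn {g : LorentzMetric E M}
    {n : ∀ x : M, TangentSpace 𝓘(ℝ, E) x} (hn : g.IsLightlikeKilling n) (c : M) :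
    IsLightlikeKillingOn (g.inChart c) (fieldInChart n c) (extChartAt 𝓘(ℝ, E) c).target where
  isOpen := isOpen_extChartAt_target c
  contDiffOn_metric := g.contDiffOn_inChart c
  contDiffOn_field := contDiffOn_fieldInChart hn.contMDiff c
  symm y _ u v := by rw [g.inChart_apply, g.inChart_apply, g.symm]
  nondeg y hy u hu := by
    have hi := isInvertible_frame hy
    have h0 : frame c y u = 0 := g.eq_zero_of_form_eq_zero _ _ fun v => by
      have := hu ((frame c y).inverse v)
      rwa [g.inChart_apply, hi.self_apply_inverse] at this
    have := hi.inverse_apply_self u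
    rw [← this, h0, map_zero]
  lightlike y hy := by
    rw [g.inChart_apply, frame_fieldInChart n hy, hn.lightlike]
  killing y hy u v := hn.killing c y hy v u

omit [FiniteDimensional ℝ E] in
theorem frame_eq_comp_fderiv {c x : M} {y : E} (hy : y ∈ (extChartAt 𝓘(ℝ, E) c).target)
    (hx : (extChartAt 𝓘(ℝ, E) c).symm y ∈ (extChartAt 𝓘(ℝ, E) x).source) (u : E) :
    (frame c y u : E) = frame x (extChartAt 𝓘(ℝ, E) x ((extChartAt 𝓘(ℝ, E) c).symm y))
      (fderiv ℝ (extChartAt 𝓘(ℝ, E) x ∘ (extChartAt 𝓘(ℝ, E) c).symm) y u) := by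
  set τ : E → E := extChartAt 𝓘(ℝ, E) x ∘ (extChartAt 𝓘(ℝ, E) c).symm with hτ
  have hev : (extChartAt 𝓘(ℝ, E) c).symm =ᶠ[𝓝 y] (extChartAt 𝓘(ℝ, E) x).symm ∘ τ := by
    filter_upwards [(continuousAt_extChartAt_symm'' hy).preimage_mem_nhds
      ((isOpen_extChartAt_source x).mem_nhds hx)] with z hz
    exact ((extChartAt 𝓘(ℝ, E) x).left_inv hz).symm
  have hmd : ∀ (d : M) {z : E}, z ∈ (extChartAt 𝓘(ℝ, E) d).target →
      MDifferentiableAt 𝓘(ℝ, E) 𝓘(ℝ, E) (extChartAt 𝓘(ℝ, E) d).symm z := fun d z hz =>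
    ((contMDiffOn_extChartAt_symm (I := 𝓘(ℝ, E)) (n := 3) d).contMDiffAt
      ((isOpen_extChartAt_target d).mem_nhds hz)).mdifferentiableAt (by norm_num)
  have hτd : MDifferentiableAt 𝓘(ℝ, E) 𝓘(ℝ, E) τ y :=
    (mdifferentiableAt_extChartAt (by rwa [extChartAt_source] at hx)).comp y (hmd c hy)
  have h2 := mfderiv_comp y (hmd x ((extChartAt 𝓘(ℝ, E) x).map_source hx)) hτd
  have h3 := hev.mfderiv_eq (I := 𝓘(ℝ, E)) (I' := 𝓘(ℝ, E))
  rw [h2, mfderiv_eq_fderiv] at h3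
  exact DFunLike.congr_fun h3 u

/-- The coordinate expressions of `dn` in the chart around `c` and in the chart around a point `x`
of its domain are related by the differential of the chart around `c`. -/
theorem LorentzMetric.dLower_frame {g : LorentzMetric E M}
    {n : ∀ x : M, TangentSpace 𝓘(ℝ, E) x} (hn : g.IsLightlikeKilling n) {c : M} {y : E}
    (hy : y ∈ (extChartAt 𝓘(ℝ, E) c).target) (u v : E) :
    g.dLower n ((extChartAt 𝓘(ℝ, E) c).symm y) (frame c y u) (frame c y v) =
      extDeriv (lower (g.inChart c) (fieldInChart n c)) y ![u, v] := by
  set x := (extChartAt 𝓘(ℝ, E) c).symm y with hx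
  set τ : E → E := extChartAt 𝓘(ℝ, E) x ∘ (extChartAt 𝓘(ℝ, E) c).symm with hτ
  have hτy : τ y = extChartAt 𝓘(ℝ, E) x x := rfl
  have hτs : ContDiffAt ℝ 3 τ y := by
    have h := contDiffWithinAt_ext_coord_change (I := 𝓘(ℝ, E)) (n := 3) x c (y := y)
      ⟨hy, mem_extChartAt_source x⟩
    rwa [modelWithCornersSelf_coe, Set.range_id, contDiffWithinAt_univ] at h
  have hfr : ∀ u, (frame c y u : E) = fderiv ℝ τ y u := fun u => by
    rw [frame_eq_comp_fderiv hy (mem_extChartAt_source x) u]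
    exact DFunLike.congr_fun (frame_self x) _
  -- Near `y` the 1-form in the chart around `c` is the pullback of the one in the chart around `x`
  -- by the transition map `τ`, and `d` commutes with pullback.
  have hpull : (fun z => (lower (g.inChart x) (fieldInChart n x) (τ z)).compContinuousLinearMap
      (fderiv ℝ τ z)) =ᶠ[𝓝 y] lower (g.inChart c) (fieldInChart n c) := by
    filter_upwards [(isOpen_extChartAt_target c).mem_nhds hy,
      (continuousAt_extChartAt_symm'' hy).preimage_mem_nhds
        ((isOpen_extChartAt_source x).mem_nhds (mem_extChartAt_source (I := 𝓘(ℝ, E)) x))]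
      with z hz hzx
    have hzx' : (extChartAt 𝓘(ℝ, E) c).symm z ∈ (extChartAt 𝓘(ℝ, E) x).source := hzx
    ext v
    change g.inChart x (τ z) (fieldInChart n x (τ z)) (fderiv ℝ τ z (v 0)) =
      g.inChart c z (fieldInChart n c z) (v 0)
    rw [g.inChart_apply, g.inChart_apply, frame_fieldInChart n hz,
      frame_fieldInChart n (y := τ z) ((extChartAt 𝓘(ℝ, E) x).map_source hzx')]
    have h1 : ∀ (p q : M) (u v : E), p = q → u = v →
        (g.form p : E → E →L[ℝ] ℝ) (n p) u = (g.form q : E → E →L[ℝ] ℝ) (n q) v := by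
      rintro p q u v rfl rfl; rfl
    exact h1 _ _ _ _ ((extChartAt 𝓘(ℝ, E) x).left_inv hzx') (frame_eq_comp_fderiv hz hzx' _).symm
  have hd := extDeriv_pullback (r := 3) (f := τ)
    ((hn.isLightlikeKillingOn x).differentiableAt_lower
      (y := τ y) (mem_extChartAt_target x)) hτs (by simp; norm_num)
  rw [hpull.extDeriv_eq] at hd
  rw [hd, LorentzMetric.dLower, coord_eq_id, hτy]
  change extDeriv (E := E) _ _ ![(frame c y u : E), (frame c y v : E)] =
    extDeriv (E := E) _ _ (fderiv ℝ τ y ∘ ![u, v])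
  rw [hfr, hfr]
  congr 1
  ext i; fin_cases i <;> rfl

end Charts

/-! ### Pointwise results on the manifold -/

section Main

variable {E : Type*} [NormedAddCommGroup E] [NormedSpace ℝ E]
  {M : Type*} [TopologicalSpace M] [ChartedSpace E M] [IsManifold 𝓘(ℝ, E) 3 M]

/-- The metric at `x` as a bilinear form on the model space. -/
def LorentzMetric.bilin (g : LorentzMetric E M) (x : M) : E →ₗ[ℝ] E →ₗ[ℝ] ℝ :=
  ContinuousLinearMap.coeLM ℝ ∘ₗ (g.form x : E →L[ℝ] E →L[ℝ] ℝ).toLinearMap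

/-- The endomorphism `u ↦ ∇_u n` at `x`. -/
def LorentzMetric.nablaEnd (g : LorentzMetric E M) (n : ∀ x : M, TangentSpace 𝓘(ℝ, E) x) (x : M) :
    E →ₗ[ℝ] E :=
  (covDeriv (g.inChart x) (fieldInChart n x) (extChartAt 𝓘(ℝ, E) x x)).toLinearMap

theorem LorentzMetric.nabla_eq (g : LorentzMetric E M) (n : ∀ x : M, TangentSpace 𝓘(ℝ, E) x)
    (x : M) (u : TangentSpace 𝓘(ℝ, E) x) : g.nabla n x u = g.nablaEnd n x u := by
  rw [LorentzMetric.nabla, coord_eq_id]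
  have : (ContinuousLinearMap.id ℝ E).inverse = ContinuousLinearMap.id ℝ E :=
    ContinuousLinearMap.inverse_id
  exact DFunLike.congr_fun this _

theorem LorentzMetric.exists_timelike (g : LorentzMetric E M) (x : M) :
    ∃ t, g.bilin x t t < 0 ∧ ∀ v, g.bilin x t v = 0 → v ≠ 0 → 0 < g.bilin x v v :=
  g.lorentzian x

namespace LorentzMetric.IsLightlikeKilling

variable [FiniteDimensional ℝ E] {g : LorentzMetric E M} {n : ∀ x : M, TangentSpace 𝓘(ℝ, E) x}
  (hn : g.IsLightlikeKilling n) (x : M)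

include hn

theorem nablaEnd_skew (u v : E) :
    g.bilin x (g.nablaEnd n x u) v + g.bilin x (g.nablaEnd n x v) u = 0 := by
  have := (hn.isLightlikeKillingOn x).killing _ (mem_extChartAt_target x) u v
  rwa [g.inChart_self, g.inChart_self] at this

theorem nablaEnd_field : g.nablaEnd n x (n x) = 0 := by
  have := (hn.isLightlikeKillingOn x).covDeriv_field (mem_extChartAt_target x)
  rwa [fieldInChart_self] at this

theorem ric_eq : g.ric x (n x) (n x) =
    -LinearMap.trace ℝ E (g.nablaEnd n x ∘ₗ g.nablaEnd n x) := by
  have := (hn.isLightlikeKillingOn x).ricci_eq (mem_extChartAt_target x)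
  rw [fieldInChart_self] at this
  rw [LorentzMetric.ric, coord_eq_id]
  exact this

theorem dLower_eq (u v : TangentSpace 𝓘(ℝ, E) x) :
    g.dLower n x u v = 2 * g.bilin x (g.nablaEnd n x u) v := by
  have := (hn.isLightlikeKillingOn x).extDeriv_lower (mem_extChartAt_target x) u v
  rw [LorentzMetric.dLower, coord_eq_id]
  exact this.trans (congrArg (2 * ·) (g.inChart_self x _ v))

theorem wedgeD_eq (p q r : TangentSpace 𝓘(ℝ, E) x) : g.wedgeD n x p q r =
    g.bilin x (n x) p * (2 * g.bilin x (g.nablaEnd n x q) r)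
      + g.bilin x (n x) q * (2 * g.bilin x (g.nablaEnd n x r) p)
      + g.bilin x (n x) r * (2 * g.bilin x (g.nablaEnd n x p) q) := by
  rw [LorentzMetric.wedgeD, hn.dLower_eq, hn.dLower_eq, hn.dLower_eq]
  rfl

omit hn in
theorem twist_eq (ε : ∀ x : M, TangentSpace 𝓘(ℝ, E) x [⋀^Fin 4]→ₗ[ℝ] ℝ)
    (u : TangentSpace 𝓘(ℝ, E) x) :
    g.twist n ε x u =
      contractTwist (g.bilin x) (tangentBasis x) (g.nablaEnd n x) (n x) (ε x) u := by
  simp only [LorentzMetric.twist, LorentzMetric.nablaUp, nabla_eq]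
  rfl

omit [FiniteDimensional ℝ E] hn in
theorem ric_of_eq_zero (h0 : n x = 0) : g.ric x (n x) (n x) = 0 := by
  have h : ∀ (G : E → E →L[ℝ] E →L[ℝ] ℝ) (y : E), ricci G y 0 0 = 0 := by
    intro G y
    unfold ricci
    refine (congrArg (LinearMap.trace ℝ E) (a₂ := 0) ?_).trans (map_zero _)
    refine LinearMap.ext fun u => ?_
    simp [riemann]
  rw [h0, LorentzMetric.ric, coord_eq_id]
  exact h _ _

omit [FiniteDimensional ℝ E] hn in
theorem wedgeD_of_eq_zero (h0 : n x = 0) (p q r : TangentSpace 𝓘(ℝ, E) x) : g.wedgeD n x p q r = 0 := by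
  have h : ∀ u, g.form x (n x) u = 0 := fun u => by rw [h0, map_zero]; rfl
  simp [LorentzMetric.wedgeD, h]

theorem exists_isNullFrame (h0 : n x ≠ 0) :
    ∃ (w : E) (k : ℕ) (e : Fin k → E), IsNullFrame (g.bilin x) (n x) w e :=
  Spacetime.exists_isNullFrame _ (g.symm x) (g.exists_timelike x) h0 (hn.lightlike x)

theorem wedgeD_eq_zero_iff :
    (∀ u v w, g.wedgeD n x u v w = 0) ↔ g.ric x (n x) (n x) = 0 := by
  by_cases h0 : n x = 0
  · exact iff_of_true (fun u v w => wedgeD_of_eq_zero x h0 u v w) (ric_of_eq_zero x h0)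
  · obtain ⟨w, k, e, h⟩ := hn.exists_isNullFrame x h0
    rw [hn.ric_eq, ← h.wedge_eq_zero_iff (hn.nablaEnd_skew x) (hn.nablaEnd_field x)]
    exact forall₃_congr fun p q r => by rw [hn.wedgeD_eq]

theorem ric_nonneg : 0 ≤ g.ric x (n x) (n x) := by
  by_cases h0 : n x = 0
  · exact (ric_of_eq_zero x h0).ge
  · obtain ⟨w, k, e, h⟩ := hn.exists_isNullFrame x h0
    rw [hn.ric_eq]
    exact h.neg_trace_sq_nonneg (hn.nablaEnd_skew x) (hn.nablaEnd_field x)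

theorem ric_eq_zero_of_finrank_le (hd : Module.finrank ℝ E ≤ 3) : g.ric x (n x) (n x) = 0 := by
  by_cases h0 : n x = 0
  · exact ric_of_eq_zero x h0
  · obtain ⟨w, k, e, h⟩ := hn.exists_isNullFrame x h0
    rw [hn.ric_eq]
    exact h.neg_trace_sq_eq_zero_of_finrank_le (hn.nablaEnd_skew x) (hn.nablaEnd_field x) hd

variable {x}

theorem exists_twist_factor (hd : Module.finrank ℝ E = 4) {U : Set M}
    {ε : ∀ x : M, TangentSpace 𝓘(ℝ, E) x [⋀^Fin 4]→ₗ[ℝ] ℝ} (hε : g.IsVolumeForm U ε)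
    (hx : x ∈ U) (h0 : n x ≠ 0) :
    ∃ c : ℝ, c ^ 2 = 8 * g.ric x (n x) (n x) ∧
      (∀ u, g.twist n ε x u = c * g.form x (n x) u) ∧
      (∀ p q r, g.wedgeD n x p q r = c / 2 * ε x ![n x, p, q, r]) ∧
      (∃ u, g.form x (n x) u ≠ 0) ∧ ∃ p q r, ε x ![n x, p, q, r] ≠ 0 := by
  obtain ⟨c, h1, h2, h3, h4, h5⟩ := Spacetime.exists_twist_factor hd (g.bilin x) (g.symm x)
    (g.exists_timelike x) h0 (hn.lightlike x) (hn.nablaEnd_skew x) (hn.nablaEnd_field x)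
    (tangentBasis x) (ε := ε x) (hε.sq_eq x hx)
  refine ⟨c, by rw [hn.ric_eq]; exact h1, fun u => ?_, fun p q r => ?_, h4, h5⟩
  · exact (twist_eq x ε u).trans (h2 u)
  · exact (hn.wedgeD_eq x p q r).trans (h3 p q r)

end LorentzMetric.IsLightlikeKilling

end Main

/-! ### The twist formula and the constancy of its sign -/

section Sign

variable {E : Type*} [NormedAddCommGroup E] [NormedSpace ℝ E]
  {M : Type*} [TopologicalSpace M] [ChartedSpace E M] [IsManifold 𝓘(ℝ, E) 3 M]
  [FiniteDimensional ℝ E] {g : LorentzMetric E M} {n : ∀ x : M, TangentSpace 𝓘(ℝ, E) x}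

/-- `wedgeD` uses a different chart at every point, so continuity is not visible from its
definition. `dLower_frame` moves it to the one chart around `c`, where `dn` is `2 G(∇N, ·)`. -/
theorem LorentzMetric.IsLightlikeKilling.continuousOn_wedgeD (hn : g.IsLightlikeKilling n) (c : M)
    (p q r : E) : ContinuousOn (fun y => g.wedgeD n ((extChartAt 𝓘(ℝ, E) c).symm y)
      (frame c y p) (frame c y q) (frame c y r)) (extChartAt 𝓘(ℝ, E) c).target := by
  have h := hn.isLightlikeKillingOn c
  have hG := h.contDiffOn_metric.continuousOn
  have hN := h.contDiffOn_field.continuousOn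
  have hA : ContinuousOn (covDeriv (g.inChart c) (fieldInChart n c))
      (extChartAt 𝓘(ℝ, E) c).target := fun y hy =>
    (h.differentiableAt_covDeriv hy).continuousAt.continuousWithinAt
  have hω : ∀ q r : E, ContinuousOn (fun y => 2 * g.inChart c y
      (covDeriv (g.inChart c) (fieldInChart n c) y q) r) (extChartAt 𝓘(ℝ, E) c).target :=
    fun q r => continuousOn_const.mul
      ((hG.clm_apply (hA.clm_apply continuousOn_const)).clm_apply continuousOn_const)
  have hl : ∀ p : E, ContinuousOn (fun y => g.inChart c y (fieldInChart n c y) p)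
      (extChartAt 𝓘(ℝ, E) c).target :=
    fun p => (hG.clm_apply hN).clm_apply continuousOn_const
  refine ContinuousOn.congr ((((hl p).mul (hω q r)).add ((hl q).mul (hω r p))).add
    ((hl r).mul (hω p q))) fun y hy => ?_
  have key : ∀ v : E, g.form ((extChartAt 𝓘(ℝ, E) c).symm y) (n _) (frame c y v) =
      g.inChart c y (fieldInChart n c y) v := fun v => by
    rw [g.inChart_apply, frame_fieldInChart n hy]
  change g.wedgeD n _ _ _ _ = _
  rw [LorentzMetric.wedgeD, key, key, key, LorentzMetric.dLower_frame hn hy,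
    LorentzMetric.dLower_frame hn hy, LorentzMetric.dLower_frame hn hy, h.extDeriv_lower hy,
    h.extDeriv_lower hy, h.extDeriv_lower hy]
  rfl

/-- Continuity of `ε` is given on constant coordinate vectors only; the varying argument `n` is
expanded in a fixed basis. -/
theorem LorentzMetric.IsVolumeForm.continuousOn_field {U : Set M}
    {ε : ∀ x : M, TangentSpace 𝓘(ℝ, E) x [⋀^Fin 4]→ₗ[ℝ] ℝ} (hε : g.IsVolumeForm U ε)
    (hn : g.IsLightlikeKilling n) (c : M) (p q r : E) :
    ContinuousOn (fun y => ε ((extChartAt 𝓘(ℝ, E) c).symm y)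
      ![n ((extChartAt 𝓘(ℝ, E) c).symm y), frame c y p, frame c y q, frame c y r])
      ((extChartAt 𝓘(ℝ, E) c).target ∩ (extChartAt 𝓘(ℝ, E) c).symm ⁻¹' U) := by
  have hN := (hn.isLightlikeKillingOn c).contDiffOn_field.continuousOn
  let b := Module.finBasis ℝ E
  have hcoord : ∀ i, ContinuousOn (fun y => b.coord i (fieldInChart n c y))
      ((extChartAt 𝓘(ℝ, E) c).target ∩ (extChartAt 𝓘(ℝ, E) c).symm ⁻¹' U) := fun i =>
    (b.coord i).continuous_of_finiteDimensional.comp_continuousOn (hN.mono Set.inter_subset_left)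
  refine ContinuousOn.congr (continuousOn_finsetSum Finset.univ fun i _ =>
    (hcoord i).mul (hε.continuousOn c ![b i, p, q, r])) fun y hy => ?_
  have hvec : ∀ v : E, (fun j => frame c y (![v, p, q, r] j)) =
      ![frame c y v, frame c y p, frame c y q, frame c y r] := fun v => by
    ext j; fin_cases j <;> rfl
  rw [← frame_fieldInChart n hy.1]
  have := b.sum_coord_mul_apply ((((curryFour (ε ((extChartAt 𝓘(ℝ, E) c).symm y))).flip
    (frame c y p)).flip (frame c y q)).flip (frame c y r) ∘ₗ (frame c y).toLinearMap)
    (fieldInChart n c y)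
  exact this.symm.trans (Finset.sum_congr rfl fun i _ =>
    congrArg (fun w => b.coord i _ * ε _ w) (hvec (b i)).symm)

namespace LorentzMetric.IsLightlikeKilling

variable {U : Set M} {ε : ∀ x : M, TangentSpace 𝓘(ℝ, E) x [⋀^Fin 4]→ₗ[ℝ] ℝ}
  (hn : g.IsLightlikeKilling n) (hd : Module.finrank ℝ E = 4) (hε : g.IsVolumeForm U ε)

include hn hd hε

theorem exists_twist_eq {x : M} (hx : x ∈ U) : ∃ s : ℝ, (s = 1 ∨ s = -1) ∧
    ∀ u, g.twist n ε x u = s * √(8 * g.ric x (n x) (n x)) * g.form x (n x) u := by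
  by_cases h0 : n x = 0
  -- At a zero of `n` both sides vanish and either sign would do.
  · refine ⟨1, Or.inl rfl, fun u => ?_⟩
    have h1 : g.form x (n x) u = 0 := by rw [h0, map_zero]; rfl
    have h2 : ∀ p q, ε x ![u, n x, p, q] = 0 := fun p q =>
      (ε x).map_coord_zero (m := ![u, n x, p, q]) 1 h0
    simp [LorentzMetric.twist, h1, h2]
  · obtain ⟨c, h1, h2, -⟩ := hn.exists_twist_factor hd hε hx h0
    rcases le_total 0 c with hc | hc
    · exact ⟨1, Or.inl rfl, fun u => by rw [h2, ← h1, Real.sqrt_sq hc, one_mul]⟩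
    · refine ⟨-1, Or.inr rfl, fun u => ?_⟩
      rw [h2, ← h1, Real.sqrt_sq_eq_abs, abs_of_nonpos hc]
      ring

omit hd in
/-- Near a point of `U` where `Ric(n, n) > 0`, the proportionality factor between the twist and `n`
does not change sign. -/
theorem eventually_twist_factor_pos_iff (hU : IsOpen U) {c : M → ℝ}
    (hc : ∀ x ∈ U, 0 < g.ric x (n x) (n x) → c x ^ 2 = 8 * g.ric x (n x) (n x) ∧
      (∀ p q r, g.wedgeD n x p q r = c x / 2 * ε x ![n x, p, q, r]) ∧
      ∃ p q r, ε x ![n x, p, q, r] ≠ 0) {x : M} (hx : x ∈ U) (hpos : 0 < g.ric x (n x) (n x)) :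
    ∀ᶠ z in 𝓝 x, 0 < g.ric z (n z) (n z) → (0 < c z ↔ 0 < c x) := by
  obtain ⟨hcx, hwx, p, q, r, hpqr⟩ := hc x hx hpos
  let φ := extChartAt 𝓘(ℝ, E) x
  -- `Φ` equals `(c / 2) ε(n, p, q, r) ^ 2`: it is continuous although `c` is chosen point by point.
  -- The square is nonzero at `x`; nearby it suffices that it is nonnegative, since the strict sign
  -- of `Φ` then forces that of `c`.
  let Φ : E → ℝ := fun y => g.wedgeD n (φ.symm y) (frame x y p) (frame x y q) (frame x y r) *
    ε (φ.symm y) ![n (φ.symm y), frame x y p, frame x y q, frame x y r]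
  let S : Set E := φ.target ∩ φ.symm ⁻¹' U
  have hΦ : ContinuousOn Φ S :=
    ((hn.continuousOn_wedgeD x p q r).mono Set.inter_subset_left).mul
      (hε.continuousOn_field hn x p q r)
  have hS : IsOpen S := (continuousOn_extChartAt_symm x).isOpen_inter_preimage
    (isOpen_extChartAt_target x) hU
  have hval : ∀ z ∈ φ.source ∩ U, 0 < g.ric z (n z) (n z) →
      ∃ e : ℝ, Φ (φ z) = c z / 2 * e ^ 2 := by
    intro z hz hzp
    have hz' : φ.symm (φ z) = z := φ.left_inv hz.1
    have key : ∀ z', z' = z → ∀ p q r : E, g.wedgeD n z' p q r * ε z' ![n z', p, q, r] =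
        c z / 2 * (ε z' ![n z', p, q, r]) ^ 2 := by
      rintro z' rfl p q r
      have := (hc z' hz.2 hzp).2.1 p q r
      rw [this]; ring
    exact ⟨_, key _ hz' (frame x (φ z) p) (frame x (φ z) q) (frame x (φ z) r)⟩
  have hxS : φ x ∈ S := ⟨mem_extChartAt_target x, by
    change φ.symm (φ x) ∈ U
    rw [φ.left_inv (mem_extChartAt_source x)]; exact hx⟩
  have hx0 : ∃ e : ℝ, e ≠ 0 ∧ Φ (φ x) = c x / 2 * e ^ 2 := by
    have key : ∀ (z : M) (p' q' r' : E), z = x → p' = p → q' = q → r' = r →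
        g.wedgeD n z p' q' r' * ε z ![n z, p', q', r'] =
          c x / 2 * (ε x ![n x, p, q, r]) ^ 2 := by
      rintro z p' q' r' rfl rfl rfl rfl
      have hw : g.wedgeD n z p' q' r' = c z / 2 * ε z ![n z, p', q', r'] := hwx p' q' r'
      rw [hw]; ring
    have hf : ∀ v : E, (frame x (φ x) v : E) = v := fun v => DFunLike.congr_fun (frame_self x) v
    exact ⟨_, hpqr, key _ _ _ _ (φ.left_inv (mem_extChartAt_source x)) (hf p) (hf q) (hf r)⟩
  obtain ⟨e, he, hΦx⟩ := hx0
  have hcont : ContinuousAt (Φ ∘ φ) x :=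
    (hΦ.continuousAt (hS.mem_nhds hxS)).comp (continuousAt_extChartAt x)
  have hsrc : ∀ᶠ z in 𝓝 x, z ∈ φ.source ∩ U :=
    Filter.inter_mem ((isOpen_extChartAt_source x).mem_nhds (mem_extChartAt_source x))
      (hU.mem_nhds hx)
  have hcx0 : c x ≠ 0 := fun h => by
    rw [h] at hcx
    nlinarith
  have he2 : 0 < e ^ 2 := by positivity
  rcases hcx0.lt_or_gt with hneg | hpos'
  · have h1 : (Φ ∘ φ) x < 0 := by
      rw [Function.comp_apply, hΦx]
      nlinarith
    filter_upwards [hsrc, hcont.eventually_lt continuousAt_const h1] with z hz hz2 hzp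
    obtain ⟨e', he'⟩ := hval z hz hzp
    rw [Function.comp_apply, he'] at hz2
    refine iff_of_false (fun h => ?_) hneg.not_gt
    nlinarith [mul_nonneg h.le (sq_nonneg e')]
  · have h1 : 0 < (Φ ∘ φ) x := by
      rw [Function.comp_apply, hΦx]
      positivity
    filter_upwards [hsrc, continuousAt_const.eventually_lt hcont h1] with z hz hz2 hzp
    obtain ⟨e', he'⟩ := hval z hz hzp
    rw [Function.comp_apply, he'] at hz2
    refine iff_of_true ?_ hpos'
    by_contra h
    nlinarith [mul_nonneg (neg_nonneg.2 (not_lt.1 h)) (sq_nonneg e')]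

/-- The sign of the factor is locally constant on `C`, hence constant by connectedness. Uniqueness
needs only one point of `C`, where neither `n` nor the square root vanishes. -/
theorem existsUnique_twist_sign (hU : IsOpen U) {C : Set M}
    (hC : C ⊆ {x ∈ U | 0 < g.ric x (n x) (n x)}) (hconn : IsConnected C) :
    ∃! s : ℝ, (s = 1 ∨ s = -1) ∧ ∀ x ∈ C,
      ∀ u, g.twist n ε x u = s * √(8 * g.ric x (n x) (n x)) * g.form x (n x) u := by
  classical
  have hn0 : ∀ x, 0 < g.ric x (n x) (n x) → n x ≠ 0 := fun x hx h0 =>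
    hx.ne' (ric_of_eq_zero x h0)
  have hex : ∀ x, ∃ c : ℝ, x ∈ U → 0 < g.ric x (n x) (n x) → c ^ 2 = 8 * g.ric x (n x) (n x) ∧
      (∀ u, g.twist n ε x u = c * g.form x (n x) u) ∧
      (∀ p q r, g.wedgeD n x p q r = c / 2 * ε x ![n x, p, q, r]) ∧
      (∃ u, g.form x (n x) u ≠ 0) ∧ ∃ p q r, ε x ![n x, p, q, r] ≠ 0 := by
    intro x
    by_cases hx : x ∈ U ∧ 0 < g.ric x (n x) (n x)
    · obtain ⟨c, hc⟩ := hn.exists_twist_factor hd hε hx.1 (hn0 x hx.2)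
      exact ⟨c, fun _ _ => hc⟩
    · exact ⟨0, fun h1 h2 => absurd ⟨h1, h2⟩ hx⟩
  choose c hc using hex
  -- As a map to the discrete space `Bool`, the sign is continuous exactly when it is locally
  -- constant.
  have hloc : ContinuousOn (fun x => decide (0 < c x)) C := by
    intro x hx
    have hev := hn.eventually_twist_factor_pos_iff hε hU
      (fun x hx hp => ⟨(hc x hx hp).1, (hc x hx hp).2.2.1, (hc x hx hp).2.2.2.2⟩)
      (hC hx).1 (hC hx).2
    refine (continuousWithinAt_const (b := decide (0 < c x))).congr_of_eventuallyEq ?_ rfl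
    filter_upwards [nhdsWithin_le_nhds hev, self_mem_nhdsWithin] with z hz hzC
    simp only [hz (hC hzC).2]
  obtain ⟨x₀, hx₀⟩ := hconn.nonempty
  have hconst : ∀ x ∈ C, (0 < c x ↔ 0 < c x₀) := fun x hx => by
    simpa using hconn.isPreconnected.constant hloc hx hx₀
  have huniq : ∀ s t : ℝ, (∀ u, g.twist n ε x₀ u =
      s * √(8 * g.ric x₀ (n x₀) (n x₀)) * g.form x₀ (n x₀) u) → (∀ u, g.twist n ε x₀ u =
      t * √(8 * g.ric x₀ (n x₀) (n x₀)) * g.form x₀ (n x₀) u) → s = t := by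
    intro s t hs ht
    obtain ⟨hU₀, hp₀⟩ := hC hx₀
    obtain ⟨u, hu⟩ := (hc x₀ hU₀ hp₀).2.2.2.1
    have hr : √(8 * g.ric x₀ (n x₀) (n x₀)) ≠ 0 := (Real.sqrt_pos.2 (by positivity)).ne'
    have := (hs u).symm.trans (ht u)
    exact mul_right_cancel₀ hr (mul_right_cancel₀ hu this)
  refine existsUnique_of_exists_of_unique ?_ fun s t hs ht => huniq s t (hs.2 x₀ hx₀) (ht.2 x₀ hx₀)
  by_cases h0 : 0 < c x₀
  · refine ⟨1, Or.inl rfl, fun x hx u => ?_⟩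
    have h := hc x (hC hx).1 (hC hx).2
    rw [h.2.1, ← h.1, Real.sqrt_sq ((hconst x hx).2 h0).le, one_mul]
  · refine ⟨-1, Or.inr rfl, fun x hx u => ?_⟩
    have h := hc x (hC hx).1 (hC hx).2
    rw [h.2.1, ← h.1, Real.sqrt_sq_eq_abs,
      abs_of_nonpos (not_lt.1 fun h' => h0 ((hconst x hx).1 h'))]
    ring

end LorentzMetric.IsLightlikeKilling

end Sign

end Spacetime

end

theorem mainTheorem7 {E : Type*} [NormedAddCommGroup E] [NormedSpace ℝ E] [FiniteDimensional ℝ E]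
    {M : Type*} [TopologicalSpace M] [ChartedSpace E M] [IsManifold 𝓘(ℝ, E) 3 M]
    (g : Spacetime.LorentzMetric E M) (n : ∀ x : M, TangentSpace 𝓘(ℝ, E) x)
    (hn : g.IsLightlikeKilling n) :
    (∀ x : M, (∀ u v w, g.wedgeD n x u v w = 0) ↔ g.ric x (n x) (n x) = 0) ∧
    (Module.finrank ℝ E ≤ 3 →
      ∀ x : M, (∀ u v w, g.wedgeD n x u v w = 0) ∧ g.ric x (n x) (n x) = 0) ∧
    (Module.finrank ℝ E = 4 →
      (∀ x : M, 0 ≤ g.ric x (n x) (n x)) ∧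
      ∀ (U : Set M), IsOpen U →
        ∀ ε : ∀ x : M, TangentSpace 𝓘(ℝ, E) x [⋀^Fin 4]→ₗ[ℝ] ℝ, g.IsVolumeForm U ε →
          (∀ x ∈ U, ∃ s : ℝ, (s = 1 ∨ s = -1) ∧
            ∀ u, g.twist n ε x u = s * √(8 * g.ric x (n x) (n x)) * g.form x (n x) u) ∧
          (∀ C : Set M, C ⊆ {x ∈ U | 0 < g.ric x (n x) (n x)} → IsConnected C →
            ∃! s : ℝ, (s = 1 ∨ s = -1) ∧ ∀ x ∈ C,
              ∀ u, g.twist n ε x u = s * √(8 * g.ric x (n x) (n x)) * g.form x (n x) u)) := by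
  refine ⟨hn.wedgeD_eq_zero_iff, fun hd x => ?_, fun hd => ⟨hn.ric_nonneg, fun U hU ε hε =>
    ⟨fun x hx => hn.exists_twist_eq hd hε hx, fun C hC hconn =>
      hn.existsUnique_twist_sign hd hε hU hC hconn⟩⟩⟩
  have h := hn.ric_eq_zero_of_finrank_le x hd
  exact ⟨(hn.wedgeD_eq_zero_iff x).2 h, h⟩
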